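/- **Notation.** Functions and distributions are complex valued, $\mathcal D'=\mathcal D'(\mathbb R)$, $D_x$ is the distributional derivative, and $L^2=L^2(\mathbb R)$ is regarded as a subspace of $\mathcal D'$. Let $n\in\mathbb N_0$. * $\mathcal C^n_p$ is the space of functions $\psi$ for which there is a finite set $I\subset\mathbb R$ such that $\psi\in C^n(\mathbb R\setminus I)$ and, for $0\le j\le n$ and $x_0\in I$, the lateral limits $\lim_{x\to x_0^\pm}\psi^{(j)}(x)$ exist and are finite. $\mathcal F^n$ is the space of $F\in\mathcal D'$ with finite support which are distributional derivatives, of some order $k\le n+1$, of a locally integrable function. $\mathcal A^n=\mathcal C^n_p\oplus\mathcal F^n\subset\mathcal D'$. * The $n$-singular support of $F\in\mathcal D'$ is the complement of the largest open set on which $F$ is a $C^n$ function. For $F\in\mathcal A^n$, an open set $\Xi$ and $g\in C^n(\Xi)$, the product $F|_\Xi\, g$ is given by $\langle F|_\Xi\, g,t\rangle=\langle F,gt\rangle$, $t\in\mathcal D(\Xi)$, where $F$ is extended continuously to compactly supported $C^n$ functions. If the $n$-singular supports of $F,G\in\mathcal A^n$ are (finite and) disjoint, the extended Hörmander product $F\cdot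 G\in\mathcal A^n$ is the distribution that, on every open set $\Xi$ on which one of the two is a $C^n(\Xi)$ function, is the product of the other one by this function. * For $F,G\in\mathcal A^n$ let $F*G=\lim_{\epsilon\downarrow0}F(x)\cdot G(x+\epsilon)$, a limit in the sense of distributions. * With $\delta^{(n)}$ the $n$-th derivative of the Dirac distribution at $0$, let $\hat\delta^{(n)}_+F=\delta^{(n)}*F$, $\hat\delta^{(n)}_-F=F*\delta^{(n)}$ and $\hat\beta^{(n)}F=\hat\delta^{(n)}_+F-\hat\delta^{(n)}_-F$ for $F\in\mathcal A^n$; write $\hat\beta=\hat\beta^{(0)}$, $\hat\beta'=\hat\beta^{(1)}$. * $\hat H_0=-D_x^2:L^2\to\mathcal D'$, and $\hat S$ is the operator in $L^2$ with domain $\mathcal D(\mathbb R\setminus\{0\})$ and $\hat S\psi=-\psi''$; $\hat S^*$ is its Hilbert space adjoint. * For $\psi\in L^2$, the expression $(\hat H_0+2\hat\beta D_x+\hat\beta')\psi$ is well defined in $\mathcal D'$ if $\psi\in\mathcal A^1$, $D_x\psi\in\mathcal A^0$ (and the products $*$ that occur in it exist). Its maximal domain is the set of all $\psi\in L^2$ for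 which it is well defined in $\mathcal D'$ and belongs to $L^2$. * $H^2(\mathbb R_-)\oplus H^2(\mathbb R_+)$ is the space of $\psi\in L^2$ whose restrictions to $\mathbb R_-=(-\infty,0)$ and $\mathbb R_+=(0,\infty)$ belong to the Sobolev spaces $H^2(\mathbb R_-)$ and $H^2(\mathbb R_+)$. **Theorem.** The adjoint of $\hat S$ is given by $$\hat S^*=\hat H_0+2\hat\beta D_x+\hat\beta' ,$$ that is, for every $\psi$ in the domain of $\hat S^*$ the right-hand side is well defined on $\psi$ and equals $\hat S^*\psi$. The domain of $\hat S^*$ is $H^2(\mathbb R_-)\oplus H^2(\mathbb R_+)$, and it coincides with the maximal domain of the right-hand side: $$\mathcal D(\hat S^*)=H^2(\mathbb R_-)\oplus H^2(\mathbb R_+)=\{\psi\in L^2:\ (\hat H_0+2\hat\beta D_x+\hat\beta')\psi\in L^2\}.$$ -/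

import Mathlib

open MeasureTheory Filter Topology TopologicalSpace Set
open scoped Distributions LineDeriv

noncomputable section

namespace PointInteraction

/-! ### Distributions on open subsets of the real line

`𝓓'(Ω, ℂ)` is Mathlib's space of complex-valued Schwartz distributions on the open set `Ω`
(tested on real test functions), `∂_{(1 : ℝ)}` is the distributional derivative `D_x`, and
`𝓓'^{n}(Ω, ℂ)` is the space of continuous functionals on compactly supported `C^n` functions. -/

/-- The distribution `t ↦ ∫ t f` on `Ω` attached to a function `f` (locally integrable on `Ω`). -/
def regularDist (Ω : Opens ℝ) (f : ℝ → ℂ) : 𝓓'(Ω, ℂ) :=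
  ContinuousLinearMap.toUniformConvergenceCLM (RingHom.id ℝ) ℂ _
    (TestFunction.integralAgainstBilinCLM (ContinuousLinearMap.lsmul ℝ ℝ) volume f)

/-- The restriction of a distribution on `ℝ` to the open set `Ω`. -/
def restrictDist (Ω : Opens ℝ) (F : 𝓓'((⊤ : Opens ℝ), ℂ)) : 𝓓'(Ω, ℂ) :=
  (TestFunction.monoCLM ℝ : 𝓓(Ω, ℝ) →L[ℝ] 𝓓((⊤ : Opens ℝ), ℝ)).precompCompactConvergenceCLM ℂ F

/-- The translate `x ↦ t (x - a)` of a test function on `ℝ`. -/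
def translateTest (a : ℝ) (t : 𝓓((⊤ : Opens ℝ), ℝ)) : 𝓓((⊤ : Opens ℝ), ℝ) :=
  ⟨fun x => t (x - a), t.contDiff.comp (contDiff_id.sub contDiff_const),
    t.hasCompactSupport.comp_homeomorph (Homeomorph.subRight a), fun _ _ => trivial⟩

theorem continuous_translateTest (a : ℝ) (K : Compacts ℝ) (hK : (K : Set ℝ) ⊆ (⊤ : Opens ℝ)) :
    Continuous (translateTest a ∘ TestFunction.ofSupportedIn (n := ⊤) (F := ℝ) hK) := by
  let K' : Compacts ℝ := K.map (fun x => x + a) (by fun_prop)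
  have hK' : (K' : Set ℝ) ⊆ (⊤ : Opens ℝ) := fun _ _ => trivial
  let A : 𝓓^{⊤}_{K}(ℝ, ℝ) →L[ℝ] 𝓓^{⊤}_{K'}(ℝ, ℝ) :=
    ContDiffMapSupportedIn.mkCLM ℝ (fun f x => f (x - a)) (fun _ _ _ => rfl) (fun _ _ _ => rfl)
      (fun f => f.contDiff.comp (contDiff_id.sub contDiff_const))
      (fun f x hx => f.zero_on_compl fun h => hx ⟨x - a, h, sub_add_cancel x a⟩)
      (fun i hi => ⟨{i}, 1, zero_le_one, fun f x _ => by
        rw [iteratedFDeriv_comp_sub]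
        simpa using ContDiffMapSupportedIn.norm_iteratedFDeriv_apply_le_seminorm ℝ hi (f := f)⟩)
  exact (TestFunction.ofSupportedInCLM ℝ hK').continuous.comp A.continuous

/-- Translation of test functions, `t ↦ t (· - a)`, as a continuous linear map. -/
def translateTestCLM (a : ℝ) : 𝓓((⊤ : Opens ℝ), ℝ) →L[ℝ] 𝓓((⊤ : Opens ℝ), ℝ) :=
  TestFunction.mkCLM ℝ (translateTest a) (fun _ _ => rfl) (fun _ _ => rfl)
    (continuous_translateTest a)

/-- The translated distribution `F(x + a)`: `⟨F(x + a), t⟩ = ⟨F, t(x - a)⟩`. -/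
def translateDist (a : ℝ) (F : 𝓓'((⊤ : Opens ℝ), ℂ)) : 𝓓'((⊤ : Opens ℝ), ℂ) :=
  (translateTestCLM a).precompCompactConvergenceCLM ℂ F

/-- The `n`-th derivative `δ^{(n)}` of the Dirac distribution at the origin. -/
def diracDeriv (n : ℕ) : 𝓓'((⊤ : Opens ℝ), ℂ) :=
  (fun F => ∂_{(1 : ℝ)} F)^[n]
    (Distribution.mapCLM Complex.ofRealCLM (Distribution.delta (0 : ℝ)))

/-! ### The spaces `C_p^n`, `F^n` and `A^n` -/

/-- `ψ ∈ C_p^n`: there is a finite set `I` such that `ψ` is `C^n` off `I` and the lateral limits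
of all derivatives of `ψ` of order `0, …, n` exist and are finite at the points of `I`. -/
def IsPiecewiseCn (n : ℕ) (ψ : ℝ → ℂ) : Prop :=
  ∃ I : Finset ℝ, ContDiffOn ℝ n ψ (I : Set ℝ)ᶜ ∧
    ∀ x₀ ∈ I, ∀ j ≤ n, (∃ l, Tendsto (iteratedDeriv j ψ) (𝓝[<] x₀) (𝓝 l)) ∧
      ∃ l, Tendsto (iteratedDeriv j ψ) (𝓝[>] x₀) (𝓝 l)

/-- `ord F ≤ m`: `F` is a distributional derivative, of some order `k ≤ m`, of a regular
distribution. -/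
def HasOrderLE (m : ℕ) (F : 𝓓'((⊤ : Opens ℝ), ℂ)) : Prop :=
  ∃ k ≤ m, ∃ h : ℝ → ℂ, LocallyIntegrable h volume ∧
    F = (fun G => ∂_{(1 : ℝ)} G)^[k] (regularDist ⊤ h)

/-- The space `F^n` of distributions with finite support and order at most `n + 1`. -/
def finiteSuppDist (n : ℕ) : Set 𝓓'((⊤ : Opens ℝ), ℂ) :=
  {F | (Distribution.dsupport F).Finite ∧ HasOrderLE (n + 1) F}

/-- The space `A^n = C_p^n ⊕ F^n`. -/
def spaceA (n : ℕ) : Set 𝓓'((⊤ : Opens ℝ), ℂ) :=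
  {F | ∃ f : ℝ → ℂ, IsPiecewiseCn n f ∧ ∃ Δ ∈ finiteSuppDist n, F = regularDist ⊤ f + Δ}

/-! ### The extended Hörmander product and the product `*` -/

/-- `F|_Ω = f` with `f ∈ C^n(Ω)`. -/
def IsCnOn (n : ℕ) (F : 𝓓'((⊤ : Opens ℝ), ℂ)) (Ω : Opens ℝ) (f : ℝ → ℂ) : Prop :=
  ContDiffOn ℝ n f Ω ∧ restrictDist Ω F = regularDist Ω f

/-- The `n`-th order singular support of `F`: the complement of the largest open set on which
`F` is a `C^n` function. -/
def singSupp (n : ℕ) (F : 𝓓'((⊤ : Opens ℝ), ℂ)) : Set ℝ :=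
  {x | ∃ Ω : Opens ℝ, x ∈ Ω ∧ ∃ f, IsCnOn n F Ω f}ᶜ

/-- The compactly supported `C^n` function `f t` on `ℝ`, for `f ∈ C^n(Ω)` and a test function `t`
on `Ω`. -/
def mulTest {n : ℕ} {Ω : Opens ℝ} {f : ℝ → ℂ} (hf : ContDiffOn ℝ n f Ω) (t : 𝓓(Ω, ℝ)) :
    𝓓^{(n : ℕ∞)}((⊤ : Opens ℝ), ℂ) where
  toFun x := (t x : ℂ) * f x
  contDiff' := by
    rw [contDiff_iff_contDiffAt]
    intro x
    by_cases hx : x ∈ tsupport t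
    · have h1 : ContDiffAt ℝ n (fun x => (t x : ℂ)) x :=
        (Complex.ofRealCLM.contDiff.comp (t.contDiff.of_le (by exact_mod_cast le_top))).contDiffAt
      exact h1.mul (hf.contDiffAt (Ω.isOpen.mem_nhds (t.tsupport_subset hx)))
    · have h0 : (fun x => (t x : ℂ) * f x) =ᶠ[𝓝 x] fun _ => 0 := by
        filter_upwards [(isClosed_tsupport (t : ℝ → ℝ)).isOpen_compl.mem_nhds hx] with y hy
        simp [image_eq_zero_of_notMem_tsupport hy]
      exact contDiffAt_const.congr_of_eventuallyEq h0
  hasCompactSupport' := by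
    refine t.hasCompactSupport.mono fun x hx => ?_
    simp only [Function.mem_support, ne_eq, mul_eq_zero, not_or, Complex.ofReal_eq_zero] at hx
    exact hx.1
  tsupport_subset' := fun _ _ => trivial

/-- The complex-linear extension of a functional on real `C^n` test functions to complex ones. -/
def evalComplex {n : ℕ} (F : 𝓓'^{(n : ℕ∞)}((⊤ : Opens ℝ), ℂ))
    (w : 𝓓^{(n : ℕ∞)}((⊤ : Opens ℝ), ℂ)) : ℂ :=
  F (TestFunction.postcompCLM Complex.reCLM w) +
    Complex.I * F (TestFunction.postcompCLM Complex.imCLM w)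

/-- `P|_Ω = F|_Ω f`: the product of `F ∈ A^n` by `f ∈ C^n(Ω)`, `⟨F f, t⟩ = ⟨F, f t⟩`, where `F` is
(uniquely) extended to a continuous functional on compactly supported `C^n` functions. -/
def IsProductOn {n : ℕ} {Ω : Opens ℝ} {f : ℝ → ℂ} (hf : ContDiffOn ℝ n f Ω)
    (F P : 𝓓'((⊤ : Opens ℝ), ℂ)) : Prop :=
  ∃ E : 𝓓'^{(n : ℕ∞)}((⊤ : Opens ℝ), ℂ),
    (∀ t : 𝓓((⊤ : Opens ℝ), ℝ), E (TestFunction.monoCLM ℝ t) = F t) ∧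
    ∀ t : 𝓓(Ω, ℝ), restrictDist Ω P t = evalComplex E (mulTest hf t)

/-- `P` is the extended Hörmander product `F · G` of `F, G ∈ A^n` with finite disjoint `n`-th order
singular supports: the element of `A^n` which, on every open set where one factor is a `C^n`
function, is the product of the other factor by that function (the complements of the two singular
supports are two such open sets, and they cover `ℝ`). -/
def IsHormanderProduct (n : ℕ) (F G P : 𝓓'((⊤ : Opens ℝ), ℂ)) : Prop :=
  F ∈ spaceA n ∧ G ∈ spaceA n ∧ (singSupp n F).Finite ∧ (singSupp n G).Finite ∧
  Disjoint (singSupp n F) (singSupp n G) ∧ P ∈ spaceA n ∧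
  (∀ (Ω : Opens ℝ) (f : ℝ → ℂ) (h : IsCnOn n F Ω f), IsProductOn h.1 G P) ∧
  (∀ (Ω : Opens ℝ) (g : ℝ → ℂ) (h : IsCnOn n G Ω g), IsProductOn h.1 F P)

/-- `H = F * G = lim_{ε ↓ 0} F(x) · G(x + ε)`, the limit being in the sense of distributions. -/
def IsStarProduct (n : ℕ) (F G H : 𝓓'((⊤ : Opens ℝ), ℂ)) : Prop :=
  ∃ P : ℝ → 𝓓'((⊤ : Opens ℝ), ℂ),
    (∀ᶠ ε in 𝓝[>] (0 : ℝ), IsHormanderProduct n F (translateDist ε G) (P ε)) ∧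
    ∀ t : 𝓓((⊤ : Opens ℝ), ℝ), Tendsto (fun ε => P ε t) (𝓝[>] 0) (𝓝 (H t))

/-- The product `F * G` of `F, G ∈ A^n`, as a partially defined distribution (`Part.Dom` says that
`F` and `G` lie in `A^n` and that the defining limit exists). -/
def starProduct (n : ℕ) (F G : 𝓓'((⊤ : Opens ℝ), ℂ)) : Part 𝓓'((⊤ : Opens ℝ), ℂ) where
  Dom := F ∈ spaceA n ∧ G ∈ spaceA n ∧ ∃ H, IsStarProduct n F G H
  get h := h.2.2.choose

/-! ### The operators on distributions

They are partial maps; sums and differences of partially defined distributions are defined when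
all the terms are. -/

/-- The `n`-th order right shifting delta `F ↦ δ^{(n)} * F`. -/
def deltaPlus (n : ℕ) (F : 𝓓'((⊤ : Opens ℝ), ℂ)) : Part 𝓓'((⊤ : Opens ℝ), ℂ) :=
  starProduct n (diracDeriv n) F

/-- The `n`-th order left shifting delta `F ↦ F * δ^{(n)}`. -/
def deltaMinus (n : ℕ) (F : 𝓓'((⊤ : Opens ℝ), ℂ)) : Part 𝓓'((⊤ : Opens ℝ), ℂ) :=
  starProduct n F (diracDeriv n)

/-- `β^{(n)} = δ^{(n)}_+ - δ^{(n)}_-`. -/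
def beta (n : ℕ) (F : 𝓓'((⊤ : Opens ℝ), ℂ)) : Part 𝓓'((⊤ : Opens ℝ), ℂ) :=
  deltaPlus n F - deltaMinus n F

/-- The space `L²(ℝ)` of complex-valued functions. -/
abbrev L2 : Type := Lp ℂ 2 (volume : Measure ℝ)

/-- The embedding of `L²(ℝ)` in the space of distributions. -/
def toDist (ψ : L2) : 𝓓'((⊤ : Opens ℝ), ℂ) := regularDist ⊤ ψ

/-- The generalized free Schrödinger operator `H₀ = -D_x² : L² → 𝓓'`. -/
def freeHamiltonian (ψ : L2) : 𝓓'((⊤ : Opens ℝ), ℂ) :=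
  -∂_{(1 : ℝ)} (∂_{(1 : ℝ)} (toDist ψ))

/-- The expression `(H₀ + 2 β D_x + β') ψ`, a partially defined distribution. -/
def boundaryExpr (ψ : L2) : Part 𝓓'((⊤ : Opens ℝ), ℂ) :=
  Part.some (freeHamiltonian ψ) +
    (beta 0 (∂_{(1 : ℝ)} (toDist ψ))).map (fun G => (2 : ℝ) • G) + beta 1 (toDist ψ)

/-- The maximal domain of `H₀ + 2 β D_x + β'`: the `ψ ∈ L²` for which the expression is
well-defined as a distribution and belongs to `L²`. -/
def maxDomain : Set L2 := {ψ | ∃ φ : L2, toDist φ ∈ boundaryExpr ψ}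

/-! ### Sobolev spaces and the operator `S` -/

/-- `f ∈ H²(Ω)`: `f` and its first two weak derivatives on `Ω` are in `L²(Ω)`. -/
def MemH2 (Ω : Opens ℝ) (f : ℝ → ℂ) : Prop :=
  MemLp f 2 (volume.restrict Ω) ∧
  (∃ g, MemLp g 2 (volume.restrict Ω) ∧ ∂_{(1 : ℝ)} (regularDist Ω f) = regularDist Ω g) ∧
  ∃ h, MemLp h 2 (volume.restrict Ω) ∧
    ∂_{(1 : ℝ)} (∂_{(1 : ℝ)} (regularDist Ω f)) = regularDist Ω h

/-- The open half-line `ℝ₋ = (-∞, 0)`. -/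
def negHalfLine : Opens ℝ := ⟨Iio 0, isOpen_Iio⟩

/-- The open half-line `ℝ₊ = (0, ∞)`. -/
def posHalfLine : Opens ℝ := ⟨Ioi 0, isOpen_Ioi⟩

/-- `H²(ℝ₋) ⊕ H²(ℝ₊)` as a subspace of `L²(ℝ) = L²(ℝ₋) ⊕ L²(ℝ₊)`. -/
def sobolevSum : Set L2 := {ψ | MemH2 negHalfLine ψ ∧ MemH2 posHalfLine ψ}

/-- `ℝ ∖ {0}` as an open set. -/
def puncturedLine : Opens ℝ := ⟨{0}ᶜ, isOpen_compl_singleton⟩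

/-- The inclusion of `𝓓(ℝ ∖ {0})` in `L²(ℝ)`. -/
def testToL2 : 𝓓(puncturedLine, ℂ) →ₗ[ℂ] L2 where
  toFun t := (t.continuous.memLp_of_hasCompactSupport t.hasCompactSupport).toLp t
  map_add' _ _ := MemLp.toLp_add _ _
  map_smul' c _ := MemLp.toLp_const_smul c _

theorem testToL2_injective : Function.Injective testToL2 := by
  intro s t h
  have h' : (s : ℝ → ℂ) =ᵐ[volume] t :=
    (MemLp.toLp_eq_toLp_iff (s.continuous.memLp_of_hasCompactSupport s.hasCompactSupport)
      (t.continuous.memLp_of_hasCompactSupport t.hasCompactSupport)).1 h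
  exact DFunLike.coe_injective (Continuous.ae_eq_iff_eq volume s.continuous t.continuous |>.1 h')

/-- The derivative `t ↦ t'` on `𝓓(ℝ ∖ {0})`. -/
def testDeriv : 𝓓(puncturedLine, ℂ) →ₗ[ℂ] 𝓓(puncturedLine, ℂ) :=
  (TestFunction.lineDerivCLM ℂ (1 : ℝ) : 𝓓(puncturedLine, ℂ) →L[ℂ] 𝓓(puncturedLine, ℂ))

/-- The symmetric operator `S`: the restriction of `-D_x²` to `𝓓(ℝ ∖ {0})`, `S t = -t''`, as an
unbounded operator in `L²(ℝ)`. -/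
def opS : L2 →ₗ.[ℂ] L2 where
  domain := LinearMap.range testToL2
  toFun := -(testToL2 ∘ₗ testDeriv ∘ₗ testDeriv ∘ₗ
    (LinearEquiv.ofInjective testToL2 testToL2_injective).symm.toLinearMap)

end PointInteraction

end

/-!
All three domains in the theorem are described by one condition: `ψ ∈ L²` belongs to each of them
if and only if there is `φ ∈ L²` with `-ψ'' = φ` in the sense of distributions on `ℝ ∖ {0}`; then
`S^* ψ = φ`.

For the adjoint this is the definition, tested on `𝓓(ℝ ∖ {0})` (`freeHamiltonian_eq_adjoint`,
`mem_adjoint_domain`). It uses that this space is dense in `L²` (`dense_opS_domain`).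

Given `-ψ'' = φ` off the origin, the distribution `ψ + ∬ φ` has zero second derivative on each
half-line, hence is affine there. So `ψ` consists of two `C¹` functions `-∬ φ + c x + d` on `ℝ`,
glued at the origin (`exists_toDist_eq`). Each of them is in `H²` of its half-line: the first
derivative is square integrable, since it differs from a difference quotient of step one by at most
the integral of `|φ|` over a window of length two (`memLp_branchDeriv`). Conversely, for `ψ` in
`H²(ℝ₋) ⊕ H²(ℝ₊)` the second derivatives on the half-lines combine to a `φ`
(`exists_of_mem_sobolevSum`).

For the boundary operator, write `[f]` for the jump of `f` at the origin. The second
distributional derivative of the glued function is `D_x² ψ = -φ + [ψ'] δ + [ψ] δ'`. In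
`δ^{(n)} * F` the singularity of `F` is moved to the left of the origin, so only the right-hand
branch of `F` is multiplied by `δ^{(n)}`; in `F * δ^{(n)}` it is the left-hand branch. Therefore
`β F = [F] δ` and `β' F = [F] δ' - [F'] δ` (`mem_beta_zero`, `mem_beta_one`). The term `[ψ] δ` in
`D_x ψ` is invisible to `β`, because the products are local. Summing up,
`-D_x² ψ + 2 β D_x ψ + β' ψ = φ + (-[ψ'] + 2 [ψ'] - [ψ']) δ + (-[ψ] + [ψ]) δ' = φ`
(`mem_boundaryExpr`). Conversely, all star products with `δ^{(n)}` are supported at the origin,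
whatever the other factor, so if the expression equals `φ`, then `-ψ'' = φ` off the origin
(`eq_of_mem_boundaryExpr`).

The value of a product with `δ_b^{(n)}` is determined by the definition
(`IsHormanderProduct.apply_eq`), since the extension of `δ_b^{(n)}` to compactly supported `C^n`
functions is unique: these are approximated by mollification (`eq_zero_of_forall_smooth`).
-/

noncomputable section

namespace PointInteraction

/-! ### Distributions on the line, tested on real functions -/

section Basics

variable {Ω : Opens ℝ}

theorem regularDist_apply {f : ℝ → ℂ} (hf : LocallyIntegrableOn f Ω) (t : 𝓓(Ω, ℝ)) :
    regularDist Ω f t = ∫ x, (t x : ℂ) * f x := by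
  change TestFunction.integralAgainstBilinCLM _ _ _ t = _
  rw [TestFunction.integralAgainstBilinCLM_eq_integral hf]
  simp

theorem regularDist_congr_ae {f g : ℝ → ℂ} (h : ∀ᵐ x, x ∈ Ω → f x = g x)
    (hf : LocallyIntegrableOn f Ω) (hg : LocallyIntegrableOn g Ω) :
    regularDist Ω f = regularDist Ω g := by
  ext t
  rw [regularDist_apply hf, regularDist_apply hg]
  refine integral_congr_ae ?_
  filter_upwards [h] with x hx
  by_cases hxΩ : x ∈ Ω
  · simp [hx hxΩ]
  · have : t x = 0 := image_eq_zero_of_notMem_tsupport fun h => hxΩ (t.tsupport_subset h)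
    simp [this]

theorem deriv_test_apply (t : 𝓓(Ω, ℝ)) (x : ℝ) : (∂_{(1 : ℝ)} t : 𝓓(Ω, ℝ)) x = deriv t x := by
  rw [TestFunction.lineDerivOp_eq_lineDerivCLM ℝ, TestFunction.lineDerivCLM_apply_of_le le_top]
  simp [lineDeriv, deriv_comp_const_add]

theorem coe_deriv_test (t : 𝓓(Ω, ℝ)) : ⇑(∂_{(1 : ℝ)} t : 𝓓(Ω, ℝ)) = deriv t :=
  funext (deriv_test_apply t)

theorem deriv_dist_apply (F : 𝓓'(Ω, ℂ)) (t : 𝓓(Ω, ℝ)) :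
    (∂_{(1 : ℝ)} F : 𝓓'(Ω, ℂ)) t = -F (∂_{(1 : ℝ)} t) := by
  rw [Distribution.lineDerivOp_apply_apply, map_neg]

/-- A test function on `Ω`, extended by zero to a test function on the line. -/
def extendTest (t : 𝓓(Ω, ℝ)) : 𝓓((⊤ : Opens ℝ), ℝ) :=
  TestFunction.monoCLM ℝ t

@[simp]
theorem coe_extendTest (t : 𝓓(Ω, ℝ)) : ⇑(extendTest t) = t := by
  simp [extendTest]

theorem extendTest_apply (t : 𝓓(Ω, ℝ)) (x : ℝ) : extendTest t x = t x := by
  simp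

theorem restrictDist_apply (F : 𝓓'((⊤ : Opens ℝ), ℂ)) (t : 𝓓(Ω, ℝ)) :
    restrictDist Ω F t = F (extendTest t) := rfl

theorem extendTest_deriv (t : 𝓓(Ω, ℝ)) :
    extendTest (∂_{(1 : ℝ)} t) = ∂_{(1 : ℝ)} (extendTest t) := by
  ext x
  rw [extendTest_apply, deriv_test_apply, deriv_test_apply, coe_extendTest]

theorem restrictDist_deriv (F : 𝓓'((⊤ : Opens ℝ), ℂ)) :
    restrictDist Ω (∂_{(1 : ℝ)} F) = ∂_{(1 : ℝ)} (restrictDist Ω F) := by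
  ext t
  rw [restrictDist_apply, deriv_dist_apply, deriv_dist_apply, restrictDist_apply, extendTest_deriv]

theorem restrictDist_regularDist {f : ℝ → ℂ} (hf : LocallyIntegrable f) :
    restrictDist Ω (regularDist ⊤ f) = regularDist Ω f := by
  ext t
  rw [restrictDist_apply, regularDist_apply (hf.locallyIntegrableOn _),
    regularDist_apply (hf.locallyIntegrableOn _), coe_extendTest]

/-- A test function on the line supported in `Ω`, as a test function on `Ω`. -/
def cutTest (t : 𝓓((⊤ : Opens ℝ), ℝ)) (h : tsupport t ⊆ Ω) : 𝓓(Ω, ℝ) :=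
  ⟨t, t.contDiff, t.hasCompactSupport, h⟩

@[simp]
theorem coe_cutTest (t : 𝓓((⊤ : Opens ℝ), ℝ)) (h : tsupport t ⊆ Ω) : ⇑(cutTest t h) = t := rfl

theorem extendTest_cutTest (t : 𝓓((⊤ : Opens ℝ), ℝ)) (h : tsupport t ⊆ Ω) :
    extendTest (cutTest t h) = t := by
  ext x; simp

theorem regularDist_zero : regularDist Ω (fun _ => 0) = 0 := by
  ext t
  rw [regularDist_apply ((locallyIntegrable_const 0).locallyIntegrableOn _)]
  simp

theorem regularDist_add {f g : ℝ → ℂ} (hf : LocallyIntegrable f) (hg : LocallyIntegrable g) :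
    regularDist Ω (fun x => f x + g x) = regularDist Ω f + regularDist Ω g := by
  ext t
  have key : ∀ {h : ℝ → ℂ}, LocallyIntegrable h → Integrable fun x => (t x : ℂ) * h x := by
    intro h hh
    simpa using t.integrable_bilin (ContinuousLinearMap.lsmul ℝ ℝ) (hh.locallyIntegrableOn Ω)
  change _ = regularDist Ω f t + regularDist Ω g t
  have hfg : LocallyIntegrable (fun x => f x + g x) := hf.add hg
  rw [regularDist_apply (hfg.locallyIntegrableOn _),
    regularDist_apply (hf.locallyIntegrableOn _), regularDist_apply (hg.locallyIntegrableOn _),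
    ← integral_add (key hf) (key hg)]
  simp [mul_add]

theorem regularDist_const_mul {f : ℝ → ℂ} (hf : LocallyIntegrable f) (c : ℂ) :
    regularDist Ω (fun x => c * f x) = c • regularDist Ω f := by
  ext t
  change _ = c • regularDist Ω f t
  have hcf : LocallyIntegrable (fun x => c * f x) := hf.smul c
  rw [regularDist_apply (hcf.locallyIntegrableOn _),
    regularDist_apply (hf.locallyIntegrableOn _), smul_eq_mul, ← integral_const_mul]
  congr 1 with x
  ring

theorem deriv_dist_add (F G : 𝓓'(Ω, ℂ)) :
    ∂_{(1 : ℝ)} (F + G) = ∂_{(1 : ℝ)} F + ∂_{(1 : ℝ)} G :=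
  LineDeriv.lineDerivOp_add _ _ _

theorem deriv_dist_smul (c : ℂ) (F : 𝓓'(Ω, ℂ)) :
    ∂_{(1 : ℝ)} (c • F) = c • ∂_{(1 : ℝ)} F := by
  ext t
  rw [deriv_dist_apply]
  change -(c • F (∂_{(1 : ℝ)} t)) = c • (∂_{(1 : ℝ)} F : 𝓓'(Ω, ℂ)) t
  rw [deriv_dist_apply, smul_neg]

theorem iterate_deriv_dist_apply (n : ℕ) (F : 𝓓'(Ω, ℂ)) (t : 𝓓(Ω, ℝ)) :
    (fun G : 𝓓'(Ω, ℂ) => ∂_{(1 : ℝ)} G)^[n] F t =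
      (-1) ^ n * F ((fun s : 𝓓(Ω, ℝ) => ∂_{(1 : ℝ)} s)^[n] t) := by
  induction n generalizing t with
  | zero => simp
  | succ n ih =>
    rw [Function.iterate_succ_apply', deriv_dist_apply, ih, ← Function.iterate_succ_apply]
    ring

theorem coe_iterate_deriv_test (n : ℕ) (t : 𝓓(Ω, ℝ)) :
    ⇑((fun s : 𝓓(Ω, ℝ) => ∂_{(1 : ℝ)} s)^[n] t) = iteratedDeriv n t := by
  induction n with
  | zero => simp
  | succ n ih =>
    rw [Function.iterate_succ_apply', coe_deriv_test, ih, iteratedDeriv_succ]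

/-- The `n`-th derivative of the Dirac distribution at `b`. -/
def diracAt (b : ℝ) (n : ℕ) : 𝓓'((⊤ : Opens ℝ), ℂ) :=
  (fun F => ∂_{(1 : ℝ)} F)^[n]
    (Distribution.mapCLM Complex.ofRealCLM (Distribution.delta b))

theorem diracAt_apply (b : ℝ) (n : ℕ) (t : 𝓓((⊤ : Opens ℝ), ℝ)) :
    diracAt b n t = (-1) ^ n * ((iteratedDeriv n t b : ℝ) : ℂ) := by
  rw [diracAt, iterate_deriv_dist_apply, Distribution.mapCLM_apply, Distribution.delta_apply,
    coe_iterate_deriv_test]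
  rfl

theorem diracAt_zero_apply (b : ℝ) (t : 𝓓((⊤ : Opens ℝ), ℝ)) : diracAt b 0 t = t b := by
  simp [diracAt_apply]

theorem diracAt_one_apply (b : ℝ) (t : 𝓓((⊤ : Opens ℝ), ℝ)) : diracAt b 1 t = -deriv t b := by
  simp [diracAt_apply]

theorem diracDeriv_eq (n : ℕ) : diracDeriv n = diracAt 0 n := rfl

theorem deriv_diracAt (b : ℝ) (n : ℕ) : ∂_{(1 : ℝ)} (diracAt b n) = diracAt b (n + 1) :=
  (Function.iterate_succ_apply' ..).symm

theorem translateDist_apply (a : ℝ) (F : 𝓓'((⊤ : Opens ℝ), ℂ)) (t : 𝓓((⊤ : Opens ℝ), ℝ)) :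
    translateDist a F t = F (translateTest a t) := rfl

theorem coe_translateTest (a : ℝ) (t : 𝓓((⊤ : Opens ℝ), ℝ)) :
    ⇑(translateTest a t) = fun x => t (x - a) := rfl

theorem translateDist_diracAt (a b : ℝ) (n : ℕ) :
    translateDist a (diracAt b n) = diracAt (b - a) n := by
  ext t
  rw [translateDist_apply, diracAt_apply, diracAt_apply, coe_translateTest,
    iteratedDeriv_comp_sub_const]

theorem translateDist_regularDist (a : ℝ) {f : ℝ → ℂ} (hf : LocallyIntegrable f)
    (hf' : LocallyIntegrable fun x => f (x + a)) :
    translateDist a (regularDist ⊤ f) = regularDist ⊤ fun x => f (x + a) := by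
  ext t
  rw [translateDist_apply, regularDist_apply (hf.locallyIntegrableOn _),
    regularDist_apply (hf'.locallyIntegrableOn _), coe_translateTest,
    ← integral_add_right_eq_self _ a]
  simp

theorem translateDist_add (a : ℝ) (F G : 𝓓'((⊤ : Opens ℝ), ℂ)) :
    translateDist a (F + G) = translateDist a F + translateDist a G := rfl

theorem translateDist_smul (a : ℝ) (c : ℂ) (F : 𝓓'((⊤ : Opens ℝ), ℂ)) :
    translateDist a (c • F) = c • translateDist a F := rfl

end Basics

/-! ### Extension of distributions to `C^n` test functions -/

section Density

open scoped Convolution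

theorem contDiff_one_iteratedDeriv {n i : ℕ} (hi : i < n) {w : ℝ → ℝ} (hw : ContDiff ℝ n w) :
    ContDiff ℝ 1 (iteratedDeriv i w) := by
  rw [iteratedDeriv_eq_iterate]
  exact ContDiff.iterate_deriv' 1 i (hw.of_le (by exact_mod_cast (by omega : 1 + i ≤ n)))

theorem hasCompactSupport_iteratedDeriv {w : ℝ → ℝ} (hw : HasCompactSupport w) (i : ℕ) :
    HasCompactSupport (iteratedDeriv i w) := by
  induction i with
  | zero => simpa using hw
  | succ i ih => rw [iteratedDeriv_succ]; exact ih.deriv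

theorem iteratedDeriv_normed_convolution (φ : ContDiffBump (0 : ℝ)) {n i : ℕ} (hi : i ≤ n)
    {w : ℝ → ℝ} (hw : ContDiff ℝ n w) (hc : HasCompactSupport w) :
    iteratedDeriv i (φ.normed volume ⋆[ContinuousLinearMap.lsmul ℝ ℝ, volume] w) =
      φ.normed volume ⋆[ContinuousLinearMap.lsmul ℝ ℝ, volume] iteratedDeriv i w := by
  induction i with
  | zero => simp
  | succ i ih =>
    rw [iteratedDeriv_succ, ih (by omega), iteratedDeriv_succ]
    ext x
    exact ((hasCompactSupport_iteratedDeriv hc i).hasDerivAt_convolution_right _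
      φ.continuous_normed.locallyIntegrable (contDiff_one_iteratedDeriv (by omega) hw) x).deriv

/-- Mollification approximates a compactly supported `C^n` function in `𝓓^n`, so a functional on
`𝓓^n` which vanishes on smooth test functions is zero. -/
theorem eq_zero_of_forall_smooth {n : ℕ} (E : 𝓓^{(n : ℕ∞)}((⊤ : Opens ℝ), ℝ) →L[ℝ] ℂ)
    (h : ∀ t : 𝓓((⊤ : Opens ℝ), ℝ), E (TestFunction.monoCLM ℝ t) = 0)
    (w : 𝓓^{(n : ℕ∞)}((⊤ : Opens ℝ), ℝ)) : E w = 0 := by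
  let K : Compacts ℝ := ⟨Metric.cthickening 1 (tsupport w),
    w.hasCompactSupport.isCompact.cthickening⟩
  have hK : (K : Set ℝ) ⊆ (⊤ : Opens ℝ) := fun _ _ => trivial
  let φ : ℕ → ContDiffBump (0 : ℝ) := fun k =>
    ⟨1 / (2 * (k + 1)), 1 / (k + 1), by positivity, by
      rw [div_lt_div_iff₀ (by positivity) (by positivity)]; linarith [k.cast_nonneg (α := ℝ)]⟩
  let m : ℕ → ℝ → ℝ := fun k =>
    (φ k).normed volume ⋆[ContinuousLinearMap.lsmul ℝ ℝ, volume] w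
  have hm : ∀ k (N : ℕ∞), ContDiff ℝ N (m k) := fun k N =>
    (φ k).hasCompactSupport_normed.contDiff_convolution_left _ (φ k).contDiff_normed
      w.continuous.locallyIntegrable
  have hsupp : ∀ k, Function.support (m k) ⊆ K := by
    intro k x hx
    obtain ⟨y, hy, z, hz, rfl⟩ := support_convolution_subset_swap _ hx
    rw [(φ k).support_normed_eq] at hz
    refine Metric.mem_cthickening_of_dist_le _ y 1 _ (subset_tsupport _ hy) ?_
    have h1 : (1 : ℝ) / (k + 1) ≤ 1 := by
      rw [div_le_one (by positivity)]; linarith [k.cast_nonneg (α := ℝ)]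
    have h2 : ‖z‖ < 1 / (k + 1) := by simpa [φ] using hz
    simp only [dist_eq_norm, add_sub_cancel_left]
    linarith
  have hwsupp : Function.support w ⊆ K :=
    (subset_tsupport _).trans (Metric.self_subset_cthickening _)
  let wK : 𝓓^{(n : ℕ∞)}_{K}(ℝ, ℝ) := .of_support_subset w.contDiff hwsupp
  let mK : ℕ → 𝓓^{(n : ℕ∞)}_{K}(ℝ, ℝ) := fun k => .of_support_subset (hm k n) (hsupp k)
  have hlim : Tendsto mK atTop (𝓝 wK) := by
    rw [(ContDiffMapSupportedIn.withSeminorms ℝ ℝ ℝ (n : ℕ∞) K).tendsto_nhds]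
    intro i ε hε
    by_cases hi : i ≤ n
    · have hcont : Continuous (iteratedDeriv i w) :=
        w.contDiff.continuous_iteratedDeriv i (by exact_mod_cast hi)
      have huc := (hasCompactSupport_iteratedDeriv
        w.hasCompactSupport i).uniformContinuous_of_continuous hcont
      obtain ⟨δ, hδ, hδ'⟩ := Metric.uniformContinuous_iff.1 huc (ε / 2) (by positivity)
      filter_upwards [tendsto_one_div_add_atTop_nhds_zero_nat.eventually (gt_mem_nhds hδ)] with k hk
      refine lt_of_le_of_lt ?_ (half_lt_self hε)
      rw [ContDiffMapSupportedIn.seminorm_le_iff ℝ (by positivity)]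
      intro _ x _
      rw [norm_iteratedFDeriv_eq_norm_iteratedDeriv]
      have h1 : ⇑(mK k - wK) = m k - w := rfl
      rw [h1, iteratedDeriv_sub ((hm k i).contDiffAt)
        (w.contDiff.contDiffAt.of_le (by exact_mod_cast hi)),
        iteratedDeriv_normed_convolution (φ k) hi w.contDiff w.hasCompactSupport, ← dist_eq_norm]
      refine (φ k).dist_normed_convolution_le hcont.aestronglyMeasurable fun y hy => (hδ' ?_).le
      exact lt_trans hy hk
    · refine Eventually.of_forall fun k => ?_
      rw [ContDiffMapSupportedIn.seminorm_eq_bot_of_gt ℝ (by exact_mod_cast not_le.1 hi)]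
      simpa using hε
  have hlim' : Tendsto (fun k => E (TestFunction.ofSupportedIn hK (mK k))) atTop
      (𝓝 (E (TestFunction.ofSupportedIn hK wK))) :=
    ((E.continuous.comp (TestFunction.continuous_ofSupportedIn hK)).tendsto _).comp hlim
  have hz : ∀ k, E (TestFunction.ofSupportedIn hK (mK k)) = 0 := by
    intro k
    rw [← h ⟨m k, hm k ⊤, HasCompactSupport.of_support_subset_isCompact K.isCompact (hsupp k),
      fun _ _ => trivial⟩]
    congr 1
    ext x
    simp only [TestFunction.monoCLM_apply, le_top, le_refl, and_self, if_true]
    rfl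
  simp only [hz] at hlim'
  have := tendsto_nhds_unique hlim' tendsto_const_nhds
  exact this

/-- The extension of a distribution to `C^n` test functions, which enters the definition of the
product, is unique. -/
theorem extension_unique {n : ℕ} {E E' : 𝓓'^{(n : ℕ∞)}((⊤ : Opens ℝ), ℂ)}
    (h : ∀ t : 𝓓((⊤ : Opens ℝ), ℝ), E (TestFunction.monoCLM ℝ t) = E' (TestFunction.monoCLM ℝ t)) :
    E = E' := by
  ext w
  let A : 𝓓^{(n : ℕ∞)}((⊤ : Opens ℝ), ℝ) →L[ℝ] ℂ := E - E'
  have hA : ∀ v, A v = E v - E' v := fun _ => rfl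
  have := eq_zero_of_forall_smooth A (fun t => by rw [hA, h, sub_self]) w
  rwa [hA, sub_eq_zero] at this

/-- The functional `w ↦ (-1)^n w^{(n)}(b)` on compactly supported `C^n` functions: the extension
of the `n`-th derivative of the Dirac distribution at `b`. -/
def diracExt (b : ℝ) (n : ℕ) : 𝓓'^{(n : ℕ∞)}((⊤ : Opens ℝ), ℂ) :=
  ContinuousLinearMap.toUniformConvergenceCLM (RingHom.id ℝ) ℂ _
    (TestFunction.limitCLM ℝ (fun w => (-1) ^ n * ((iteratedDeriv n w b : ℝ) : ℂ))
      (fun K _ => ((-1 : ℝ) ^ n • Complex.ofRealCLM) ∘L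
        (ContinuousMultilinearMap.apply ℝ (fun _ : Fin n => ℝ) ℝ (fun _ => 1)) ∘L
        (BoundedContinuousFunction.evalCLM ℝ b) ∘L
        ContDiffMapSupportedIn.structureMapCLM ℝ (n : ℕ∞) n)
      (fun K hK f => by
        simp [iteratedDeriv_eq_iteratedFDeriv]))

theorem diracExt_apply (b : ℝ) (n : ℕ) (w : 𝓓^{(n : ℕ∞)}((⊤ : Opens ℝ), ℝ)) :
    diracExt b n w = (-1) ^ n * ((iteratedDeriv n w b : ℝ) : ℂ) := rfl

theorem diracExt_mono (b : ℝ) (n : ℕ) (t : 𝓓((⊤ : Opens ℝ), ℝ)) :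
    diracExt b n (TestFunction.monoCLM ℝ t) = diracAt b n t := by
  rw [diracExt_apply, diracAt_apply]
  simp

/-- The extension of the derivatives of the Dirac distribution, on complex functions. -/
theorem evalComplex_diracExt (b : ℝ) (n : ℕ) (w : 𝓓^{(n : ℕ∞)}((⊤ : Opens ℝ), ℂ)) :
    evalComplex (diracExt b n) w = (-1) ^ n * iteratedDeriv n w b := by
  have key : ∀ L : ℂ →L[ℝ] ℝ, iteratedDeriv n (L ∘ w) b = L (iteratedDeriv n w b) := by
    intro L
    rw [iteratedDeriv_eq_iteratedFDeriv, iteratedDeriv_eq_iteratedFDeriv,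
      L.iteratedFDeriv_comp_left (w.contDiff.contDiffAt) le_rfl]
    rfl
  rw [evalComplex, diracExt_apply, diracExt_apply]
  simp only [TestFunction.postcompCLM_apply, key, Complex.reCLM_apply, Complex.imCLM_apply]
  conv_rhs => rw [← Complex.re_add_im (iteratedDeriv n w b)]
  ring

end Density

/-! ### Products with a derivative of the Dirac distribution -/

section Hormander

variable {Ω : Opens ℝ}

theorem integrable_test_mul {f : ℝ → ℂ} (hf : LocallyIntegrableOn f Ω) (t : 𝓓(Ω, ℝ)) :
    Integrable fun x => (t x : ℂ) * f x := by
  simpa using t.integrable_bilin (ContinuousLinearMap.lsmul ℝ ℝ) hf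

theorem ae_eq_of_regularDist_eq {f g : ℝ → ℂ} (hf : LocallyIntegrableOn f Ω)
    (hg : LocallyIntegrableOn g Ω) (h : regularDist Ω f = regularDist Ω g) :
    ∀ᵐ x, x ∈ Ω → f x = g x := by
  have key : ∀ᵐ x, x ∈ (Ω : Set ℝ) → (fun x => f x - g x) x = 0 := by
    refine Ω.isOpen.ae_eq_zero_of_integral_contDiff_smul_eq_zero (hf.sub hg) fun t ht hc hs => ?_
    let T : 𝓓(Ω, ℝ) := ⟨t, ht, hc, hs⟩
    have h1 := regularDist_apply hf T
    rw [h, regularDist_apply hg T] at h1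
    have h2 : ∀ x, t x • (f x - g x) = (T x : ℂ) * f x - (T x : ℂ) * g x := by
      intro x
      rw [Complex.real_smul, mul_sub]
      rfl
    simp_rw [h2]
    rw [integral_sub (integrable_test_mul hf T) (integrable_test_mul hg T), h1, sub_self]
  filter_upwards [key] with x hx hxΩ
  exact sub_eq_zero.1 (hx hxΩ)

theorem eqOn_of_regularDist_eq {f g : ℝ → ℂ} (hf : ContinuousOn f Ω) (hg : ContinuousOn g Ω)
    (h : regularDist Ω f = regularDist Ω g) : EqOn f g Ω := by
  have h1 := ae_eq_of_regularDist_eq (hf.locallyIntegrableOn Ω.isOpen.measurableSet)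
    (hg.locallyIntegrableOn Ω.isOpen.measurableSet) h
  exact Measure.eqOn_open_of_ae_eq ((ae_restrict_iff' Ω.isOpen.measurableSet).2 h1)
    Ω.isOpen hf hg

/-- The `C^n` function representing a distribution on an open set is unique. -/
theorem IsCnOn.eqOn {n : ℕ} {F : 𝓓'((⊤ : Opens ℝ), ℂ)} {U V : Opens ℝ} {f g : ℝ → ℂ}
    (hf : IsCnOn n F U f) (hg : IsCnOn n F V g) : EqOn f g (U ∩ V : Set ℝ) := by
  have hres : ∀ {W : Opens ℝ} {k : ℝ → ℂ}, IsCnOn n F W k → (U ⊓ V ≤ W) →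
      restrictDist (U ⊓ V) F = regularDist (U ⊓ V) k := by
    intro W k hk hW
    ext t
    have h1 := congrArg (fun G : 𝓓'(W, ℂ) => G (TestFunction.monoCLM ℝ t)) hk.2
    have hW' : W.1 ⊇ (U ⊓ V).1 := hW
    have hloc := hk.1.continuousOn.locallyIntegrableOn (μ := volume) W.isOpen.measurableSet
    simp only [restrictDist_apply, regularDist_apply hloc] at h1
    rw [restrictDist_apply, regularDist_apply (hloc.mono_set hW')]
    convert h1 using 2
    · ext x; simp [hW]
    · ext x; simp [hW]
  refine eqOn_of_regularDist_eq (Ω := U ⊓ V) (hf.1.continuousOn.mono inter_subset_left)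
    (hg.1.continuousOn.mono inter_subset_right) ?_
  rw [← hres hf inf_le_left, ← hres hg inf_le_right]

theorem test_eventuallyEq_zero {t : ℝ → ℝ} {b : ℝ} (h : b ∉ tsupport t) : t =ᶠ[𝓝 b] 0 :=
  notMem_tsupport_iff_eventuallyEq.1 h

theorem iteratedDeriv_mul_eq_zero {t : ℝ → ℝ} {b : ℝ} (h : b ∉ tsupport t) (f : ℝ → ℂ) (n : ℕ) :
    iteratedDeriv n (fun x => (t x : ℂ) * f x) b = 0 := by
  have : (fun x => (t x : ℂ) * f x) =ᶠ[𝓝 b] fun _ => 0 := by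
    filter_upwards [test_eventuallyEq_zero h] with x hx
    simp [hx]
  rw [(this.iteratedDeriv n).eq_of_nhds]
  simp

theorem diracAt_apply_eq_zero {b : ℝ} {n : ℕ} {t : 𝓓((⊤ : Opens ℝ), ℝ)} (h : b ∉ tsupport t) :
    diracAt b n t = 0 := by
  rw [diracAt_apply, ((test_eventuallyEq_zero h).iteratedDeriv n).eq_of_nhds]
  have : iteratedDeriv n (0 : ℝ → ℝ) b = 0 := by
    change iteratedDeriv n (fun _ => 0) b = 0
    simp
  simp [this]

theorem isCnOn_diracAt_zero (n : ℕ) (b : ℝ) {U : Opens ℝ} (hb : b ∉ U) :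
    IsCnOn n (diracAt b n) U (fun _ => 0) := by
  refine ⟨contDiffOn_const, ?_⟩
  rw [regularDist_zero]
  ext t
  rw [restrictDist_apply, diracAt_apply_eq_zero]
  · rfl
  · rw [coe_extendTest]
    exact fun h => hb (t.tsupport_subset h)

/-- A derivative of the Dirac distribution at `b` is not represented by a `C^n` function near `b`;
away from `b` it is represented by zero only. -/
theorem IsCnOn.diracAt {n : ℕ} {b : ℝ} {f : ℝ → ℂ} (h : IsCnOn n (diracAt b n) Ω f) :
    b ∉ Ω ∧ EqOn f 0 Ω := by
  have hzero : EqOn f 0 Ω := by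
    have h1 : EqOn f 0 ((Ω : Set ℝ) ∩ {b}ᶜ) :=
      h.eqOn (isCnOn_diracAt_zero n b (U := ⟨{b}ᶜ, isOpen_compl_singleton⟩) (fun h => h rfl))
    refine Measure.eqOn_open_of_ae_eq (μ := volume) ?_ Ω.isOpen h.1.continuousOn continuousOn_const
    rw [EventuallyEq, ae_restrict_iff' Ω.isOpen.measurableSet]
    have hb : ∀ᵐ x : ℝ, x ≠ b := by simp [ae_iff]
    filter_upwards [hb] with x hx hxΩ
    exact h1 ⟨hxΩ, hx⟩
  refine ⟨fun hb => ?_, hzero⟩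
  obtain ⟨χ, hχ⟩ : ∃ χ : ContDiffBump b, tsupport χ ⊆ Ω := by
    obtain ⟨r, hr, hr'⟩ := Metric.nhds_basis_closedBall.mem_iff.1 (Ω.isOpen.mem_nhds hb)
    exact ⟨⟨r / 2, r, by positivity, by linarith⟩, by rwa [ContDiffBump.tsupport_eq]⟩
  -- a test function which equals `(x - b) ^ n` near `b`
  let T : 𝓓(Ω, ℝ) := ⟨fun x => χ x * (x - b) ^ n,
    χ.contDiff.mul ((contDiff_id.sub contDiff_const).pow n), χ.hasCompactSupport.mul_right,
    (closure_mono (Function.support_mul_subset_left _ _)).trans hχ⟩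
  have h1 := congrArg (fun G : 𝓓'(Ω, ℂ) => G T) h.2
  simp only [restrictDist_apply] at h1
  rw [regularDist_apply (h.1.continuousOn.locallyIntegrableOn Ω.isOpen.measurableSet),
    diracAt_apply, coe_extendTest] at h1
  have h2 : ∀ x, (T x : ℂ) * f x = 0 := by
    intro x
    by_cases hx : x ∈ Ω
    · simp [hzero hx]
    · have : T x = 0 := image_eq_zero_of_notMem_tsupport fun h => hx (T.tsupport_subset h)
      simp [this]
  have h3 : (T : ℝ → ℝ) =ᶠ[𝓝 b] fun x => (x - b) ^ n := by
    filter_upwards [χ.eventuallyEq_one] with x hx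
    change χ x * (x - b) ^ n = _
    simp [hx]
  rw [(h3.iteratedDeriv n).eq_of_nhds, iteratedDeriv_comp_sub_const n (fun x => x ^ n)] at h1
  simp [h2, iteratedDeriv_pow, Nat.descFactorial_self, Nat.factorial_ne_zero] at h1

theorem evalComplex_zero {n : ℕ} (E : 𝓓'^{(n : ℕ∞)}((⊤ : Opens ℝ), ℂ)) : evalComplex E 0 = 0 := by
  rw [evalComplex, map_zero, map_zero, map_zero]
  simp

theorem mulTest_eq_zero {n : ℕ} {f : ℝ → ℂ} (hf : ContDiffOn ℝ n f Ω) (h : EqOn f 0 Ω)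
    (t : 𝓓(Ω, ℝ)) : mulTest hf t = 0 := by
  ext x
  change (t x : ℂ) * f x = 0
  by_cases hx : x ∈ Ω
  · simp [h hx]
  · have : t x = 0 := image_eq_zero_of_notMem_tsupport fun h => hx (t.tsupport_subset h)
    simp [this]

theorem coe_mulTest {n : ℕ} {f : ℝ → ℂ} (hf : ContDiffOn ℝ n f Ω) (t : 𝓓(Ω, ℝ)) :
    ⇑(mulTest hf t) = fun x => (t x : ℂ) * f x := rfl

theorem IsHormanderProduct.symm {n : ℕ} {F G P : 𝓓'((⊤ : Opens ℝ), ℂ)}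
    (h : IsHormanderProduct n F G P) : IsHormanderProduct n G F P :=
  ⟨h.2.1, h.1, h.2.2.2.1, h.2.2.1, h.2.2.2.2.1.symm, h.2.2.2.2.2.1, h.2.2.2.2.2.2.2,
    h.2.2.2.2.2.2.1⟩

/-- A product with a derivative of the Dirac distribution at `b` vanishes off `b`. -/
theorem IsHormanderProduct.apply_eq_zero {n : ℕ} {b : ℝ} {F P : 𝓓'((⊤ : Opens ℝ), ℂ)}
    (h : IsHormanderProduct n (PointInteraction.diracAt b n) F P) {t : 𝓓((⊤ : Opens ℝ), ℝ)}
    (ht : b ∉ tsupport t) : P t = 0 := by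
  let U : Opens ℝ := ⟨{b}ᶜ, isOpen_compl_singleton⟩
  obtain ⟨E, -, hE⟩ := h.2.2.2.2.2.2.1 U _ (isCnOn_diracAt_zero n b (U := U) (fun h => h rfl))
  have htU : tsupport t ⊆ U := fun x hx => by
    rintro rfl
    exact ht hx
  have := hE (cutTest t htU)
  rwa [restrictDist_apply, extendTest_cutTest, mulTest_eq_zero _ (fun _ _ => rfl),
    evalComplex_zero] at this

/-- A product `δ_b^{(n)} · F`, where `F` is a `C^n` function `f` near `b`, is
`t ↦ (-1)^n (t f)^{(n)}(b)`. -/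
theorem IsHormanderProduct.apply_eq {n : ℕ} {b : ℝ} {F P : 𝓓'((⊤ : Opens ℝ), ℂ)}
    (h : IsHormanderProduct n (PointInteraction.diracAt b n) F P) {U : Opens ℝ} {f : ℝ → ℂ}
    (hf : IsCnOn n F U f) (hb : b ∈ U) (t : 𝓓((⊤ : Opens ℝ), ℝ)) :
    P t = (-1) ^ n * iteratedDeriv n (fun x => (t x : ℂ) * f x) b := by
  obtain ⟨χ, hχ⟩ : ∃ χ : ContDiffBump b, tsupport χ ⊆ U := by
    obtain ⟨r, hr, hr'⟩ := Metric.nhds_basis_closedBall.mem_iff.1 (U.isOpen.mem_nhds hb)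
    exact ⟨⟨r / 2, r, by positivity, by linarith⟩, by rwa [ContDiffBump.tsupport_eq]⟩
  -- localize `t` to `U`: the difference vanishes near `b`, where `P` is supported
  let t₁ : 𝓓((⊤ : Opens ℝ), ℝ) := ⟨fun x => χ x * t x, χ.contDiff.mul t.contDiff,
    χ.hasCompactSupport.mul_right, fun _ _ => trivial⟩
  have ht₁ : (t₁ : ℝ → ℝ) =ᶠ[𝓝 b] t := by
    filter_upwards [χ.eventuallyEq_one] with x hx
    change χ x * t x = t x
    simp [hx]
  have hs₁ : tsupport t₁ ⊆ U := (closure_mono (Function.support_mul_subset_left _ _)).trans hχ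
  have h0 : P (t - t₁) = 0 := by
    refine h.apply_eq_zero (notMem_tsupport_iff_eventuallyEq.2 ?_)
    filter_upwards [ht₁] with x hx
    simp [hx]
  obtain ⟨E, hE, hE'⟩ := h.2.2.2.2.2.2.2 U f hf
  have hEd : E = diracExt b n := extension_unique fun s => by rw [hE, diracExt_mono]
  have h1 := hE' (cutTest t₁ hs₁)
  rw [restrictDist_apply, extendTest_cutTest, hEd, evalComplex_diracExt, coe_mulTest] at h1
  rw [map_sub, sub_eq_zero] at h0
  rw [h0, h1]
  congr 1
  refine Filter.EventuallyEq.eq_of_nhds (Filter.EventuallyEq.iteratedDeriv ?_ n)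
  filter_upwards [ht₁] with x hx
  rw [coe_cutTest, hx]

/-- Existence of the product `δ_b^{(n)} · F`, where `F` is a `C^n` function near `b`. -/
theorem isHormanderProduct_diracAt {n : ℕ} {b : ℝ} {F P : 𝓓'((⊤ : Opens ℝ), ℂ)}
    (hδA : diracAt b n ∈ spaceA n) (hF : F ∈ spaceA n) (hFs : (singSupp n F).Finite)
    (hext : ∃ E : 𝓓'^{(n : ℕ∞)}((⊤ : Opens ℝ), ℂ),
      ∀ t : 𝓓((⊤ : Opens ℝ), ℝ), E (TestFunction.monoCLM ℝ t) = F t)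
    {U : Opens ℝ} {f : ℝ → ℂ} (hf : IsCnOn n F U f) (hb : b ∈ U) (hP : P ∈ spaceA n)
    (hPt : ∀ t : 𝓓((⊤ : Opens ℝ), ℝ),
      P t = (-1) ^ n * iteratedDeriv n (fun x => (t x : ℂ) * f x) b) :
    IsHormanderProduct n (diracAt b n) F P := by
  have hsing : singSupp n (diracAt b n) ⊆ {b} := by
    intro x hx
    by_contra hxb
    exact hx ⟨⟨{b}ᶜ, isOpen_compl_singleton⟩, hxb, _, isCnOn_diracAt_zero n b fun h => h rfl⟩
  refine ⟨hδA, hF, (finite_singleton b).subset hsing, hFs, ?_, hP, ?_, ?_⟩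
  · rw [Set.disjoint_left]
    rintro x hx hx'
    obtain rfl : x = b := hsing hx
    exact hx' ⟨U, hb, f, hf⟩
  · intro Ω g hg
    obtain ⟨E, hE⟩ := hext
    refine ⟨E, hE, fun t => ?_⟩
    have := hg.diracAt
    rw [mulTest_eq_zero _ this.2, evalComplex_zero, restrictDist_apply, hPt,
      iteratedDeriv_mul_eq_zero, mul_zero]
    rw [coe_extendTest]
    exact fun h => this.1 (t.tsupport_subset h)
  · intro Ω g hg
    refine ⟨diracExt b n, diracExt_mono b n, fun t => ?_⟩
    rw [restrictDist_apply, hPt, evalComplex_diracExt, coe_mulTest, coe_extendTest]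
    congr 1
    by_cases hbΩ : b ∈ Ω
    · refine Filter.EventuallyEq.eq_of_nhds (Filter.EventuallyEq.iteratedDeriv ?_ n)
      filter_upwards [U.isOpen.mem_nhds hb, Ω.isOpen.mem_nhds hbΩ] with x hx hx'
      rw [hf.eqOn hg ⟨hx, hx'⟩]
    · have : b ∉ tsupport t := fun h => hbΩ (t.tsupport_subset h)
      rw [iteratedDeriv_mul_eq_zero this, iteratedDeriv_mul_eq_zero this]

end Hormander

/-! ### Primitives, and functions with one jump -/

section Primitive

theorem continuous_primitive {g : ℝ → ℂ} (hg : LocallyIntegrable g) (a : ℝ) :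
    Continuous fun x => ∫ s in a..x, g s :=
  intervalIntegral.continuous_primitive
    (fun _ _ => (hg.integrableOn_isCompact isCompact_uIcc).intervalIntegrable) a

theorem integral_deriv_test (t : 𝓓((⊤ : Opens ℝ), ℝ)) :
    ∫ x, ((deriv t x : ℝ) : ℂ) = 0 := by
  rw [integral_complex_ofReal, integral_eq_zero_of_hasDerivAt_of_integrable
    (fun x => ((t.contDiff.differentiable (by simp)) x).hasDerivAt)
    ((t.contDiff.continuous_deriv (by simp)).integrable_of_hasCompactSupport
      t.hasCompactSupport.deriv) (t.continuous.integrable_of_hasCompactSupport t.hasCompactSupport)]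
  simp

/-- Integration by parts against the primitive of a locally integrable function, by Fubini. -/
theorem integral_deriv_test_mul_primitive {g : ℝ → ℂ} (hg : LocallyIntegrable g) (a : ℝ)
    (t : 𝓓((⊤ : Opens ℝ), ℝ)) :
    ∫ x, ((deriv t x : ℝ) : ℂ) * ∫ s in a..x, g s = -∫ x, (t x : ℂ) * g x := by
  obtain ⟨R, hR⟩ := t.hasCompactSupport.isCompact.isBounded.subset_closedBall 0
  rw [Real.closedBall_eq_Icc, zero_sub, zero_add] at hR
  have hint : ∀ c d, IntervalIntegrable g volume c d := fun c d =>
    (hg.integrableOn_isCompact isCompact_uIcc).intervalIntegrable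
  let G : ℝ → ℂ := (Icc (-R) R).indicator g
  have hG : Integrable G := (integrable_indicator_iff measurableSet_Icc).2
    (hg.integrableOn_isCompact isCompact_Icc)
  have hdc : Continuous (deriv t) := t.contDiff.continuous_deriv (by simp)
  have hdi : Integrable fun x => ((deriv t x : ℝ) : ℂ) :=
    (hdc.integrable_of_hasCompactSupport t.hasCompactSupport.deriv).ofReal
  have hds : ∀ x, x ∉ Icc (-R) R → deriv t x = 0 := fun x hx =>
    by_contra fun h => hx (hR (support_deriv_subset h))
  -- write the primitive as a constant plus an integral over `s ≤ x` of an integrable function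
  have h1 : ∀ x, ((deriv t x : ℝ) : ℂ) * ∫ s in a..x, g s =
      ((deriv t x : ℝ) : ℂ) * (∫ s in a..(-R), g s) +
        ∫ s, {p : ℝ × ℝ | p.2 ≤ p.1}.indicator
          (fun p => ((deriv t p.1 : ℝ) : ℂ) * G p.2) (x, s) := by
    intro x
    by_cases hx : x ∈ Icc (-R) R
    · rw [← intervalIntegral.integral_add_adjacent_intervals (hint a (-R)) (hint (-R) x), mul_add]
      congr 1
      rw [← intervalIntegral.integral_const_mul, intervalIntegral.integral_of_le hx.1,
        ← integral_Icc_eq_integral_Ioc, ← integral_indicator measurableSet_Icc]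
      congr 1 with s
      by_cases hs : s ≤ x
      · by_cases hs' : -R ≤ s
        · have h2 : s ∈ Icc (-R) R := ⟨hs', hs.trans hx.2⟩
          simp [indicator, hs, hs', G, h2.2]
        · simp [indicator, hs, hs', G]
      · simp [indicator, hs]
    · simp [indicator, hds x hx]
  have hprod : Integrable ({p : ℝ × ℝ | p.2 ≤ p.1}.indicator
      (fun p => ((deriv t p.1 : ℝ) : ℂ) * G p.2)) (volume.prod volume) :=
    (hdi.mul_prod hG).indicator (measurableSet_le measurable_snd measurable_fst)
  simp_rw [h1]
  rw [integral_add (hdi.mul_const _) hprod.integral_prod_left, integral_mul_const,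
    integral_deriv_test, zero_mul, zero_add, integral_integral_swap (f := fun x s =>
      {p : ℝ × ℝ | p.2 ≤ p.1}.indicator (fun p => ((deriv t p.1 : ℝ) : ℂ) * G p.2) (x, s)) hprod,
    ← integral_neg]
  congr 1 with s
  have h3 : ∀ x, {p : ℝ × ℝ | p.2 ≤ p.1}.indicator
      (fun p => ((deriv t p.1 : ℝ) : ℂ) * G p.2) (x, s) =
      (Ici s).indicator (fun x => ((deriv t x : ℝ) : ℂ) * G s) x := fun x => by
    simp [indicator]
  simp_rw [h3]
  rw [integral_indicator measurableSet_Ici, integral_mul_const, integral_Ici_eq_integral_Ioi,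
    integral_complex_ofReal, HasCompactSupport.integral_Ioi_deriv_eq (t.contDiff.of_le (by simp))
      t.hasCompactSupport]
  by_cases hs : s ∈ Icc (-R) R
  · simp [G, indicator_of_mem hs]
  · have : t s = 0 := image_eq_zero_of_notMem_tsupport fun h => hs (hR h)
    simp [this]

theorem deriv_primitive {g : ℝ → ℂ} (hg : LocallyIntegrable g) (a : ℝ) :
    ∂_{(1 : ℝ)} (regularDist ⊤ fun x => ∫ s in a..x, g s) = regularDist ⊤ g := by
  ext t
  rw [deriv_dist_apply,
    regularDist_apply ((continuous_primitive hg a).locallyIntegrable.locallyIntegrableOn _),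
    regularDist_apply (hg.locallyIntegrableOn _), coe_deriv_test,
    integral_deriv_test_mul_primitive hg, neg_neg]

theorem deriv_const (c : ℂ) : ∂_{(1 : ℝ)} (regularDist ⊤ fun _ => c) = 0 := by
  ext t
  rw [deriv_dist_apply, regularDist_apply ((locallyIntegrable_const c).locallyIntegrableOn _),
    coe_deriv_test, integral_mul_const, integral_deriv_test, zero_mul, neg_zero]
  rfl

/-- The function `p (x - a)` for `x < a`, `q (x - a)` for `x ≥ a`: it may jump at `a`. -/
def jumpFun (p q : ℝ → ℂ) (a : ℝ) (x : ℝ) : ℂ := if x < a then p (x - a) else q (x - a)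

theorem locallyIntegrable_jumpFun {p q : ℝ → ℂ} (hp : Continuous p) (hq : Continuous q) (a : ℝ) :
    LocallyIntegrable (jumpFun p q a) := by
  have h : jumpFun p q a =
      (Iio a).indicator (fun x => p (x - a)) + (Ici a).indicator (fun x => q (x - a)) := by
    ext x
    by_cases hx : x < a
    · simp [jumpFun, hx]
    · simp [jumpFun, hx, not_lt.1 hx]
  rw [h]
  exact ((hp.comp (continuous_sub_right a)).locallyIntegrable.indicator measurableSet_Iio).add
    ((hq.comp (continuous_sub_right a)).locallyIntegrable.indicator measurableSet_Ici)

/-- The Heaviside function at `a`. -/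
def heaviside (a : ℝ) : ℝ → ℂ := jumpFun (fun _ => 0) (fun _ => 1) a

theorem locallyIntegrable_heaviside (a : ℝ) : LocallyIntegrable (heaviside a) :=
  locallyIntegrable_jumpFun continuous_const continuous_const a

theorem deriv_heaviside (a : ℝ) : ∂_{(1 : ℝ)} (regularDist ⊤ (heaviside a)) = diracAt a 0 := by
  ext t
  rw [deriv_dist_apply, regularDist_apply ((locallyIntegrable_heaviside a).locallyIntegrableOn _),
    coe_deriv_test, diracAt_zero_apply]
  have h : ∀ x, ((deriv t x : ℝ) : ℂ) * heaviside a x =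
      (Ici a).indicator (fun x => ((deriv t x : ℝ) : ℂ)) x := by
    intro x
    by_cases hx : x < a
    · simp [heaviside, jumpFun, hx]
    · simp [heaviside, jumpFun, hx, not_lt.1 hx]
  simp_rw [h]
  rw [integral_indicator measurableSet_Ici, integral_Ici_eq_integral_Ioi,
    integral_complex_ofReal, HasCompactSupport.integral_Ioi_deriv_eq (t.contDiff.of_le (by simp))
      t.hasCompactSupport]
  simp

theorem isPiecewiseCn_jumpFun {n : ℕ} {p q : ℝ → ℂ} (hp : ContDiff ℝ n p) (hq : ContDiff ℝ n q)
    (a : ℝ) : IsPiecewiseCn n (jumpFun p q a) := by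
  have hl : ∀ x < a, jumpFun p q a =ᶠ[𝓝 x] fun x => p (x - a) := fun x hx => by
    filter_upwards [Iio_mem_nhds hx] with y hy
    exact if_pos hy
  have hr : ∀ x > a, jumpFun p q a =ᶠ[𝓝 x] fun x => q (x - a) := fun x hx => by
    filter_upwards [Ioi_mem_nhds hx] with y hy
    exact if_neg (not_lt.2 (le_of_lt hy))
  have hp' : ContDiff ℝ n fun x => p (x - a) := hp.comp (contDiff_id.sub contDiff_const)
  have hq' : ContDiff ℝ n fun x => q (x - a) := hq.comp (contDiff_id.sub contDiff_const)
  refine ⟨{a}, fun x hx => ContDiffAt.contDiffWithinAt ?_, fun x₀ hx₀ j hj => ?_⟩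
  · rcases lt_or_gt_of_ne (show x ≠ a by simpa using hx) with h | h
    · exact hp'.contDiffAt.congr_of_eventuallyEq (hl x h)
    · exact hq'.contDiffAt.congr_of_eventuallyEq (hr x h)
  · obtain rfl : x₀ = a := by simpa using hx₀
    have hj' : (j : WithTop ℕ∞) ≤ n := by exact_mod_cast hj
    refine ⟨⟨_, (((hp'.continuous_iteratedDeriv j hj').tendsto x₀).mono_left
      nhdsWithin_le_nhds).congr' ?_⟩,
      ⟨_, (((hq'.continuous_iteratedDeriv j hj').tendsto x₀).mono_left
      nhdsWithin_le_nhds).congr' ?_⟩⟩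
    · filter_upwards [self_mem_nhdsWithin] with x hx
      exact ((hl x hx).iteratedDeriv j).eq_of_nhds.symm
    · filter_upwards [self_mem_nhdsWithin] with x hx
      exact ((hr x hx).iteratedDeriv j).eq_of_nhds.symm

theorem dsupport_finite_of_forall {F : 𝓓'((⊤ : Opens ℝ), ℂ)} {a : ℝ}
    (h : ∀ t : 𝓓((⊤ : Opens ℝ), ℝ), a ∉ tsupport t → F t = 0) :
    (Distribution.dsupport F).Finite := by
  refine (finite_singleton a).subset fun x hx => ?_
  rw [Distribution.mem_dsupport_iff] at hx
  refine hx {a} (fun t ht => h t fun hat => ?_) isClosed_singleton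
  exact ht hat rfl

theorem smul_diracAt_zero_mem_finiteSuppDist (n : ℕ) (c : ℂ) (a : ℝ) :
    c • diracAt a 0 ∈ finiteSuppDist n := by
  refine ⟨dsupport_finite_of_forall (a := a) fun t ht => ?_, 1, by omega,
    fun x => c * heaviside a x, (locallyIntegrable_heaviside a).smul c, ?_⟩
  · change c • diracAt a 0 t = 0
    rw [diracAt_apply_eq_zero ht, smul_zero]
  · rw [Function.iterate_one, regularDist_const_mul (locallyIntegrable_heaviside a),
      deriv_dist_smul, deriv_heaviside]

/-- `δ'` and `δ` are the second derivatives of the Heaviside function and of its primitive. -/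
theorem diracAt_one_mem_finiteSuppDist (c d : ℂ) (a : ℝ) :
    c • diracAt a 1 + d • diracAt a 0 ∈ finiteSuppDist 1 := by
  have hH := locallyIntegrable_heaviside a
  have hR : LocallyIntegrable fun x => ∫ s in a..x, heaviside a s :=
    (continuous_primitive hH a).locallyIntegrable
  refine ⟨dsupport_finite_of_forall (a := a) fun t ht => ?_, 2, le_rfl,
    fun x => c * heaviside a x + d * ∫ s in a..x, heaviside a s,
    (hH.smul c).add (hR.smul d), ?_⟩
  · change c • diracAt a 1 t + d • diracAt a 0 t = 0
    rw [diracAt_apply_eq_zero ht, diracAt_apply_eq_zero ht, smul_zero, smul_zero, add_zero]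
  · have hcH : LocallyIntegrable fun x => c * heaviside a x := hH.smul c
    have hdR : LocallyIntegrable fun x => d * ∫ s in a..x, heaviside a s := hR.smul d
    rw [regularDist_add hcH hdR]
    change _ = ∂_{(1 : ℝ)} (∂_{(1 : ℝ)} (_ + _))
    rw [regularDist_const_mul hH, regularDist_const_mul hR, deriv_dist_add,
      deriv_dist_smul, deriv_dist_smul, deriv_primitive hH, deriv_dist_add, deriv_dist_smul,
      deriv_dist_smul, deriv_heaviside, deriv_diracAt]

theorem finiteSuppDist_subset_spaceA (n : ℕ) : finiteSuppDist n ⊆ spaceA n := fun Δ hΔ =>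
  ⟨fun _ => 0, ⟨∅, contDiffOn_const, by simp⟩, Δ, hΔ, by rw [regularDist_zero, zero_add]⟩

/-- For `n ≤ 1`, the product of a `C^n` function `f` with `δ_b^{(n)}` lies in `A^n`. -/
theorem exists_mul_diracAt {n : ℕ} (hn : n ≤ 1) {f : ℝ → ℂ} (hf : ContDiff ℝ n f) (b : ℝ) :
    ∃ P ∈ spaceA n, ∀ t : 𝓓((⊤ : Opens ℝ), ℝ),
      P t = (-1) ^ n * iteratedDeriv n (fun x => (t x : ℂ) * f x) b := by
  interval_cases n
  · refine ⟨f b • diracAt b 0,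
      finiteSuppDist_subset_spaceA 0 (smul_diracAt_zero_mem_finiteSuppDist 0 _ b), fun t => ?_⟩
    change f b • diracAt b 0 t = _
    rw [diracAt_zero_apply]
    simp [mul_comm]
  · refine ⟨f b • diracAt b 1 + (-deriv f b) • diracAt b 0,
      finiteSuppDist_subset_spaceA 1 (diracAt_one_mem_finiteSuppDist _ _ b), fun t => ?_⟩
    change f b • diracAt b 1 t + (-deriv f b) • diracAt b 0 t = _
    have h1 : HasDerivAt (fun x => (t x : ℂ)) ((deriv t b : ℝ) : ℂ) b :=
      ((t.contDiff.differentiable (by simp)) b).hasDerivAt.ofReal_comp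
    have h2 : HasDerivAt f (deriv f b) b := (hf.differentiable (by simp) b).hasDerivAt
    rw [diracAt_zero_apply, diracAt_one_apply, iteratedDeriv_one,
      show deriv (fun x => (t x : ℂ) * f x) b = _ from (h1.mul h2).deriv]
    simp only [smul_eq_mul]
    ring

end Primitive

/-! ### Star products with derivatives of the Dirac distribution -/

section Star

/-- `Part.get` of the star product is a chosen limit, so membership needs uniqueness of the
limit. -/
theorem mem_starProduct {n : ℕ} {F G H : 𝓓'((⊤ : Opens ℝ), ℂ)} (hF : F ∈ spaceA n)
    (hG : G ∈ spaceA n) (hH : IsStarProduct n F G H)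
    (huniq : ∀ H', IsStarProduct n F G H' → H' = H) : H ∈ starProduct n F G :=
  ⟨⟨hF, hG, H, hH⟩, huniq _ (Exists.choose_spec (⟨H, hH⟩ : ∃ H, IsStarProduct n F G H))⟩

/-- The distribution `f + c δ_a`, with `f` the function `p (x - a)` for `x < a` and `q (x - a)`
for `x ≥ a`. -/
def jumpDist (p q : ℝ → ℂ) (c : ℂ) (a : ℝ) : 𝓓'((⊤ : Opens ℝ), ℂ) :=
  regularDist ⊤ (jumpFun p q a) + c • diracAt a 0

variable {n : ℕ} {p q : ℝ → ℂ} (c : ℂ)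

theorem jumpDist_mem_spaceA (hp : ContDiff ℝ n p) (hq : ContDiff ℝ n q) (a : ℝ) :
    jumpDist p q c a ∈ spaceA n :=
  ⟨_, isPiecewiseCn_jumpFun hp hq a, _, smul_diracAt_zero_mem_finiteSuppDist n c a, rfl⟩

theorem translateDist_jumpDist (hp : Continuous p) (hq : Continuous q) (a b : ℝ) :
    translateDist b (jumpDist p q c a) = jumpDist p q c (a - b) := by
  have h : (fun x => jumpFun p q a (x + b)) = jumpFun p q (a - b) := by
    ext x
    simp only [jumpFun, lt_sub_iff_add_lt, sub_sub_eq_add_sub]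
  rw [jumpDist, translateDist_add, translateDist_smul, translateDist_diracAt,
    translateDist_regularDist b (locallyIntegrable_jumpFun hp hq a), h]
  · rfl
  · rw [h]
    exact locallyIntegrable_jumpFun hp hq _

theorem isCnOn_jumpDist (hp : Continuous p) (hq : Continuous q) {a : ℝ} {U : Opens ℝ}
    (ha : a ∉ U) {f : ℝ → ℂ} (hf : ContDiff ℝ n f) (h : EqOn (jumpFun p q a) f U) :
    IsCnOn n (jumpDist p q c a) U f := by
  refine ⟨hf.contDiffOn, ?_⟩
  have hloc := locallyIntegrable_jumpFun hp hq a
  ext t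
  rw [restrictDist_apply]
  change regularDist ⊤ _ _ + c • diracAt a 0 (extendTest t) = _
  rw [diracAt_apply_eq_zero, smul_zero, add_zero, ← restrictDist_apply,
    restrictDist_regularDist hloc, regularDist_congr_ae (Eventually.of_forall h)
      (hloc.locallyIntegrableOn _) (hf.continuous.locallyIntegrable.locallyIntegrableOn _)]
  rw [coe_extendTest]
  exact fun h => ha (t.tsupport_subset h)

theorem isCnOn_jumpDist_left (hp : ContDiff ℝ n p) (hq : Continuous q) (a : ℝ) :
    IsCnOn n (jumpDist p q c a) ⟨Iio a, isOpen_Iio⟩ fun x => p (x - a) :=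
  isCnOn_jumpDist c hp.continuous hq (lt_irrefl a)
    (hp.comp (contDiff_id.sub contDiff_const)) fun _ hx => if_pos hx

theorem isCnOn_jumpDist_right (hp : Continuous p) (hq : ContDiff ℝ n q) (a : ℝ) :
    IsCnOn n (jumpDist p q c a) ⟨Ioi a, isOpen_Ioi⟩ fun x => q (x - a) :=
  isCnOn_jumpDist c hp hq.continuous (lt_irrefl a)
    (hq.comp (contDiff_id.sub contDiff_const)) fun _ hx => if_neg (not_lt.2 (le_of_lt hx))

theorem singSupp_jumpDist_finite (hp : ContDiff ℝ n p) (hq : ContDiff ℝ n q) (a : ℝ) :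
    (singSupp n (jumpDist p q c a)).Finite := by
  refine (finite_singleton a).subset fun x hx => ?_
  by_contra hxa
  rcases lt_or_gt_of_ne hxa with h | h
  · exact hx ⟨_, h, _, isCnOn_jumpDist_left c hp hq.continuous a⟩
  · exact hx ⟨_, h, _, isCnOn_jumpDist_right c hp.continuous hq a⟩

/-- `f + c δ_a` is of order zero, hence extends to `C^n` test functions for every `n`. -/
theorem exists_extension_jumpDist (n : ℕ) (hp : Continuous p) (hq : Continuous q) (a : ℝ) :
    ∃ E : 𝓓'^{(n : ℕ∞)}((⊤ : Opens ℝ), ℂ), ∀ t : 𝓓((⊤ : Opens ℝ), ℝ),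
      E (TestFunction.monoCLM ℝ t) = jumpDist p q c a t := by
  have hloc := (locallyIntegrable_jumpFun hp hq a).locallyIntegrableOn ((⊤ : Opens ℝ) : Set ℝ)
  let E₁ : 𝓓'^{(n : ℕ∞)}((⊤ : Opens ℝ), ℂ) :=
    ContinuousLinearMap.toUniformConvergenceCLM (RingHom.id ℝ) ℂ _
      (TestFunction.integralAgainstBilinCLM (ContinuousLinearMap.lsmul ℝ ℝ) volume
        (jumpFun p q a))
  let E₂ : 𝓓'^{(n : ℕ∞)}((⊤ : Opens ℝ), ℂ) :=
    Distribution.mapCLM Complex.ofRealCLM (Distribution.delta a)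
  refine ⟨E₁ + c • E₂, fun t => ?_⟩
  change TestFunction.integralAgainstBilinCLM _ _ _ _ +
    c • ((TestFunction.monoCLM ℝ t : 𝓓^{(n : ℕ∞)}((⊤ : Opens ℝ), ℝ)) a : ℂ) =
    regularDist ⊤ (jumpFun p q a) t + c • diracAt a 0 t
  rw [TestFunction.integralAgainstBilinCLM_eq_integral hloc, regularDist_apply hloc,
    diracAt_zero_apply]
  simp

variable {c} {H : 𝓓'((⊤ : Opens ℝ), ℂ)}

theorem diracAt_mem_spaceA (hn : n ≤ 1) (b : ℝ) : diracAt b n ∈ spaceA n := by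
  interval_cases n
  · simpa using finiteSuppDist_subset_spaceA 0 (smul_diracAt_zero_mem_finiteSuppDist 0 1 b)
  · have h : diracAt b 1 = (1 : ℂ) • diracAt b 1 + (0 : ℂ) • diracAt b 0 := by
      ext t
      change diracAt b 1 t = (1 : ℂ) • diracAt b 1 t + (0 : ℂ) • diracAt b 0 t
      simp
    rw [h]
    exact finiteSuppDist_subset_spaceA 1 (diracAt_one_mem_finiteSuppDist 1 0 b)

theorem contDiff_test_mul (t : 𝓓((⊤ : Opens ℝ), ℝ)) {f : ℝ → ℂ} (hf : ContDiff ℝ n f) :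
    ContDiff ℝ n fun x => (t x : ℂ) * f x :=
  (Complex.ofRealCLM.contDiff.comp (t.contDiff.of_le (by exact_mod_cast le_top))).mul hf

theorem tendsto_iteratedDeriv_test_mul_shift (hn : n ≤ 1) (t : 𝓓((⊤ : Opens ℝ), ℝ)) {f : ℝ → ℂ}
    (hf : ContDiff ℝ n f) :
    Tendsto (fun ε => iteratedDeriv n (fun x => (t x : ℂ) * f (x + ε)) 0) (𝓝 0)
      (𝓝 (iteratedDeriv n (fun x => (t x : ℂ) * f x) 0)) := by
  interval_cases n
  · simp only [iteratedDeriv_zero, zero_add]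
    exact (hf.continuous.tendsto 0).const_mul _
  · have key : ∀ ε, iteratedDeriv 1 (fun x => (t x : ℂ) * f (x + ε)) 0 =
        ((deriv t 0 : ℝ) : ℂ) * f ε + t 0 * deriv f ε := by
      intro ε
      have h1 : HasDerivAt (fun x => (t x : ℂ)) ((deriv t 0 : ℝ) : ℂ) 0 :=
        ((t.contDiff.differentiable (by simp)) 0).hasDerivAt.ofReal_comp
      have h2 : HasDerivAt (fun x => f (x + ε)) (deriv f ε) 0 := by
        apply HasDerivAt.comp_add_const
        rw [zero_add]
        exact (hf.differentiable (by simp) ε).hasDerivAt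
      rw [iteratedDeriv_one, show deriv (fun x => (t x : ℂ) * f (x + ε)) 0 = _ from
        (h1.mul h2).deriv, zero_add]
    have h3 := key 0
    simp only [add_zero] at h3
    simp_rw [key]
    rw [h3]
    exact ((hf.continuous.tendsto 0).const_mul _).add
      (((hf.continuous_deriv (by simp)).tendsto 0).const_mul _)

/-- `δ^{(n)} * F` is the product of `δ^{(n)}` by the right-hand part of `F`. -/
theorem mem_deltaPlus (hn : n ≤ 1) (hp : ContDiff ℝ n p) (hq : ContDiff ℝ n q)
    (hH : ∀ t : 𝓓((⊤ : Opens ℝ), ℝ),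
      H t = (-1) ^ n * iteratedDeriv n (fun x => (t x : ℂ) * q x) 0) :
    H ∈ deltaPlus n (jumpDist p q c 0) := by
  have hshift : ∀ ε : ℝ, ContDiff ℝ n fun x => q (x + ε) := fun ε =>
    hq.comp (contDiff_id.add contDiff_const)
  have hcn : ∀ ε : ℝ, IsCnOn n (translateDist ε (jumpDist p q c 0))
      ⟨Ioi (0 - ε), isOpen_Ioi⟩ fun x => q (x + ε) := fun ε => by
    rw [translateDist_jumpDist c hp.continuous hq.continuous]
    convert isCnOn_jumpDist_right c hp.continuous hq (0 - ε) using 3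
    ring
  have hlim : ∀ t : 𝓓((⊤ : Opens ℝ), ℝ), Tendsto (fun ε : ℝ => (-1) ^ n *
      iteratedDeriv n (fun x => (t x : ℂ) * q (x + ε)) 0) (𝓝[>] 0) (𝓝 (H t)) := fun t => by
    rw [hH]
    exact ((tendsto_iteratedDeriv_test_mul_shift hn t hq).mono_left nhdsWithin_le_nhds).const_mul _
  rw [deltaPlus, diracDeriv_eq]
  refine mem_starProduct (diracAt_mem_spaceA hn 0) (jumpDist_mem_spaceA c hp hq 0) ?_ ?_
  · choose P hPA hPt using fun ε : ℝ => exists_mul_diracAt hn (hshift ε) 0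
    refine ⟨P, ?_, fun t => (hlim t).congr fun ε => (hPt ε t).symm⟩
    filter_upwards [self_mem_nhdsWithin] with ε hε
    refine isHormanderProduct_diracAt (diracAt_mem_spaceA hn 0) ?_ ?_ ?_ (hcn ε) ?_ (hPA ε) (hPt ε)
    · rw [translateDist_jumpDist c hp.continuous hq.continuous]
      exact jumpDist_mem_spaceA c hp hq _
    · rw [translateDist_jumpDist c hp.continuous hq.continuous]
      exact singSupp_jumpDist_finite c hp hq _
    · rw [translateDist_jumpDist c hp.continuous hq.continuous]
      exact exists_extension_jumpDist c n hp.continuous hq.continuous _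
    · change 0 - ε < 0
      linarith [mem_Ioi.1 hε]
  · rintro H' ⟨P, hP, hPt⟩
    ext t
    refine tendsto_nhds_unique (hPt t) ((hlim t).congr' ?_)
    filter_upwards [hP, self_mem_nhdsWithin] with ε hε hε'
    refine (hε.apply_eq (hcn ε) ?_ t).symm
    change 0 - ε < 0
    linarith [mem_Ioi.1 hε']

/-- `F * δ^{(n)}` is the product of `δ^{(n)}` by the left-hand part of `F`. -/
theorem mem_deltaMinus (hn : n ≤ 1) (hp : ContDiff ℝ n p) (hq : ContDiff ℝ n q)
    (hH : ∀ t : 𝓓((⊤ : Opens ℝ), ℝ),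
      H t = (-1) ^ n * iteratedDeriv n (fun x => (t x : ℂ) * p x) 0) :
    H ∈ deltaMinus n (jumpDist p q c 0) := by
  have hcn : IsCnOn n (jumpDist p q c 0) ⟨Iio 0, isOpen_Iio⟩ p := by
    simpa using isCnOn_jumpDist_left c hp hq.continuous 0
  have hlim : ∀ t : 𝓓((⊤ : Opens ℝ), ℝ), Tendsto (fun ε : ℝ => (-1) ^ n *
      iteratedDeriv n (fun x => (t x : ℂ) * p x) (0 - ε)) (𝓝[>] 0) (𝓝 (H t)) := fun t => by
    rw [hH]
    have h1 : Continuous fun ε : ℝ => iteratedDeriv n (fun x => (t x : ℂ) * p x) (0 - ε) :=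
      ((contDiff_test_mul t hp).continuous_iteratedDeriv n le_rfl).comp (continuous_sub_left 0)
    have h2 := h1.tendsto 0
    rw [sub_zero] at h2
    exact (h2.mono_left nhdsWithin_le_nhds).const_mul _
  have hmem : ∀ {ε : ℝ}, ε ∈ Ioi (0 : ℝ) → 0 - ε ∈ (⟨Iio 0, isOpen_Iio⟩ : Opens ℝ) :=
    fun {ε} hε => by
      change 0 - ε < 0
      linarith [mem_Ioi.1 hε]
  rw [deltaMinus, diracDeriv_eq]
  refine mem_starProduct (jumpDist_mem_spaceA c hp hq 0) (diracAt_mem_spaceA hn 0) ?_ ?_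
  · choose P hPA hPt using fun ε : ℝ => exists_mul_diracAt hn hp (0 - ε)
    refine ⟨P, ?_, fun t => (hlim t).congr fun ε => (hPt ε t).symm⟩
    filter_upwards [self_mem_nhdsWithin] with ε hε
    rw [translateDist_diracAt]
    exact (isHormanderProduct_diracAt (diracAt_mem_spaceA hn _) (jumpDist_mem_spaceA c hp hq _)
      (singSupp_jumpDist_finite c hp hq _)
      (exists_extension_jumpDist c n hp.continuous hq.continuous _) hcn (hmem hε) (hPA ε)
      (hPt ε)).symm
  · rintro H' ⟨P, hP, hPt⟩
    ext t
    refine tendsto_nhds_unique (hPt t) ((hlim t).congr' ?_)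
    filter_upwards [hP, self_mem_nhdsWithin] with ε hε hε'
    rw [translateDist_diracAt] at hε
    exact (hε.symm.apply_eq hcn (hmem hε') t).symm

/-- `β F = [F] δ`, where `[F]` is the jump of `F` at the origin; a multiple of `δ` in `F` does not
contribute. -/
theorem mem_beta_zero (hp : Continuous p) (hq : Continuous q) :
    (q 0 - p 0) • diracAt 0 0 ∈ beta 0 (jumpDist p q c 0) := by
  have hp' : ContDiff ℝ (0 : ℕ) p := contDiff_zero.2 hp
  have hq' : ContDiff ℝ (0 : ℕ) q := contDiff_zero.2 hq
  rw [show (q 0 - p 0) • diracAt 0 0 = q 0 • diracAt 0 0 - p 0 • diracAt 0 0 from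
    sub_smul (q 0) (p 0) (diracAt 0 0)]
  refine Part.sub_mem_sub _ _ _ _ (mem_deltaPlus zero_le_one hp' hq' fun t => ?_)
    (mem_deltaMinus zero_le_one hp' hq' fun t => ?_)
  · change q 0 • diracAt 0 0 t = _
    simp [diracAt_zero_apply, mul_comm]
  · change p 0 • diracAt 0 0 t = _
    simp [diracAt_zero_apply, mul_comm]

/-- `β' F = [F] δ' - [F'] δ`. -/
theorem mem_beta_one (hp : ContDiff ℝ 1 p) (hq : ContDiff ℝ 1 q) :
    (q 0 - p 0) • diracAt 0 1 - (deriv q 0 - deriv p 0) • diracAt 0 0 ∈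
      beta 1 (jumpDist p q c 0) := by
  have key : ∀ {f : ℝ → ℂ}, ContDiff ℝ 1 f → ∀ t : 𝓓((⊤ : Opens ℝ), ℝ),
      (f 0 • diracAt 0 1 - deriv f 0 • diracAt 0 0) t =
        (-1) ^ 1 * iteratedDeriv 1 (fun x => (t x : ℂ) * f x) 0 := by
    intro f hf t
    have h1 : HasDerivAt (fun x => (t x : ℂ)) ((deriv t 0 : ℝ) : ℂ) 0 :=
      ((t.contDiff.differentiable (by simp)) 0).hasDerivAt.ofReal_comp
    have h2 : HasDerivAt f (deriv f 0) 0 := (hf.differentiable (by simp) 0).hasDerivAt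
    change f 0 • diracAt 0 1 t - deriv f 0 • diracAt 0 0 t = _
    rw [diracAt_zero_apply, diracAt_one_apply, iteratedDeriv_one,
      show deriv (fun x => (t x : ℂ) * f x) 0 = _ from (h1.mul h2).deriv]
    simp only [smul_eq_mul]
    ring
  have hsum : (q 0 - p 0) • diracAt 0 1 - (deriv q 0 - deriv p 0) • diracAt 0 0 =
      (q 0 • diracAt 0 1 - deriv q 0 • diracAt 0 0) -
        (p 0 • diracAt 0 1 - deriv p 0 • diracAt 0 0) := by
    ext t
    change (q 0 - p 0) • diracAt 0 1 t - (deriv q 0 - deriv p 0) • diracAt 0 0 t =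
      (q 0 • diracAt 0 1 t - deriv q 0 • diracAt 0 0 t) -
        (p 0 • diracAt 0 1 t - deriv p 0 • diracAt 0 0 t)
    simp only [sub_smul]
    ring
  rw [hsum]
  exact Part.sub_mem_sub _ _ _ _ (mem_deltaPlus le_rfl hp hq (key hq))
    (mem_deltaMinus le_rfl hp hq (key hp))

end Star

section StarSupport

variable {n : ℕ} {F H : 𝓓'((⊤ : Opens ℝ), ℂ)}

theorem apply_eq_zero_of_mem_deltaPlus (h : H ∈ deltaPlus n F) {t : 𝓓((⊤ : Opens ℝ), ℝ)}
    (ht : (0 : ℝ) ∉ tsupport t) : H t = 0 := by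
  obtain ⟨hd, rfl⟩ := h
  obtain ⟨P, hP, hlim⟩ := hd.2.2.choose_spec
  refine tendsto_nhds_unique (hlim t) (tendsto_const_nhds.congr' ?_)
  filter_upwards [hP] with ε hε
  exact (hε.apply_eq_zero ht).symm

theorem apply_eq_zero_of_mem_deltaMinus (h : H ∈ deltaMinus n F) {t : 𝓓((⊤ : Opens ℝ), ℝ)}
    (ht : (0 : ℝ) ∉ tsupport t) : H t = 0 := by
  obtain ⟨hd, rfl⟩ := h
  obtain ⟨P, hP, hlim⟩ := hd.2.2.choose_spec
  refine tendsto_nhds_unique (hlim t) (tendsto_const_nhds.congr' ?_)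
  have hev : ∀ᶠ ε in 𝓝[>] (0 : ℝ), 0 - ε ∉ tsupport t := by
    have h1 : Tendsto (fun ε : ℝ => 0 - ε) (𝓝[>] 0) (𝓝 0) := by
      simpa using ((continuous_sub_left (0 : ℝ)).tendsto 0).mono_left nhdsWithin_le_nhds
    exact h1 ((isClosed_tsupport _).isOpen_compl.mem_nhds ht)
  filter_upwards [hP, hev] with ε hε hε'
  rw [diracDeriv_eq, translateDist_diracAt] at hε
  exact (hε.symm.apply_eq_zero hε').symm

theorem apply_eq_zero_of_mem_beta (h : H ∈ beta n F) {t : 𝓓((⊤ : Opens ℝ), ℝ)}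
    (ht : (0 : ℝ) ∉ tsupport t) : H t = 0 := by
  rw [beta, Part.sub_def] at h
  simp only [Part.bind_eq_bind, Part.mem_bind_iff, Part.mem_map_iff] at h
  obtain ⟨A, hA, B, hB, rfl⟩ := h
  change A t - B t = 0
  rw [apply_eq_zero_of_mem_deltaPlus hA ht, apply_eq_zero_of_mem_deltaMinus hB ht, sub_zero]

end StarSupport

/-! ### The adjoint in terms of distributions -/

section Adjoint

theorem locallyIntegrable_L2 (ψ : L2) : LocallyIntegrable (ψ : ℝ → ℂ) :=
  (Lp.memLp ψ).locallyIntegrable (by norm_num)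

theorem toDist_apply (ψ : L2) (t : 𝓓((⊤ : Opens ℝ), ℝ)) : toDist ψ t = ∫ x, (t x : ℂ) * ψ x :=
  regularDist_apply ((locallyIntegrable_L2 ψ).locallyIntegrableOn _) t

/-- A real test function, regarded as a complex one. -/
def complexTest {Ω : Opens ℝ} (t : 𝓓(Ω, ℝ)) : 𝓓(Ω, ℂ) :=
  TestFunction.postcompCLM Complex.ofRealCLM t

theorem complexTest_apply {Ω : Opens ℝ} (t : 𝓓(Ω, ℝ)) (x : ℝ) : complexTest t x = t x := rfl

theorem testDeriv_apply (t : 𝓓(puncturedLine, ℂ)) (x : ℝ) : testDeriv t x = deriv t x := by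
  change (TestFunction.lineDerivCLM ℂ (1 : ℝ) t : 𝓓(puncturedLine, ℂ)) x = _
  rw [TestFunction.lineDerivCLM_apply_of_le le_top]
  simp [lineDeriv, deriv_comp_const_add]

theorem testDeriv_complexTest (t : 𝓓(puncturedLine, ℝ)) :
    testDeriv (complexTest t) = complexTest (∂_{(1 : ℝ)} t) := by
  ext x
  rw [testDeriv_apply, complexTest_apply, deriv_test_apply]
  exact ((t.contDiff.differentiable (by simp)) x).hasDerivAt.ofReal_comp.deriv

theorem exists_re_im_test (T : 𝓓(puncturedLine, ℂ)) :
    ∃ u v : 𝓓(puncturedLine, ℝ), T = complexTest u + Complex.I • complexTest v := by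
  refine ⟨TestFunction.postcompCLM Complex.reCLM T, TestFunction.postcompCLM Complex.imCLM T, ?_⟩
  ext x
  change T x = ((T x).re : ℂ) + Complex.I * ((T x).im : ℂ)
  rw [mul_comm, Complex.re_add_im]

theorem inner_testToL2_complexTest (ψ : L2) (t : 𝓓(puncturedLine, ℝ)) :
    inner ℂ ψ (testToL2 (complexTest t)) = (starRingEnd ℂ) (toDist ψ (extendTest t)) := by
  rw [L2.inner_def, toDist_apply, ← integral_conj]
  refine integral_congr_ae ?_
  filter_upwards [MemLp.coeFn_toLp ((complexTest t).continuous.memLp_of_hasCompactSupport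
    (p := 2) (μ := (volume : Measure ℝ)) (complexTest t).hasCompactSupport)] with x hx
  have hx' : testToL2 (complexTest t) x = complexTest t x := hx
  rw [hx', complexTest_apply, extendTest_apply]
  simp [mul_comm]

theorem testToL2_mem (t : 𝓓(puncturedLine, ℂ)) : testToL2 t ∈ opS.domain := ⟨t, rfl⟩

theorem opS_apply (t : 𝓓(puncturedLine, ℂ)) :
    opS ⟨testToL2 t, testToL2_mem t⟩ = -testToL2 (testDeriv (testDeriv t)) := by
  have h1 : (LinearEquiv.ofInjective testToL2 testToL2_injective).symm
      ⟨testToL2 t, testToL2_mem t⟩ = t := by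
    rw [LinearEquiv.symm_apply_eq]
    rfl
  change -testToL2 (testDeriv (testDeriv
    ((LinearEquiv.ofInjective testToL2 testToL2_injective).symm ⟨testToL2 t, testToL2_mem t⟩))) = _
  rw [h1]

/-- Density of the domain of `S`; without it, the adjoint would be the junk value zero. -/
theorem dense_opS_domain : Dense (opS.domain : Set L2) := by
  rw [Submodule.dense_iff_topologicalClosure_eq_top, Submodule.topologicalClosure_eq_top_iff,
    Submodule.eq_bot_iff]
  intro ψ hψ
  have h1 : ∀ t : 𝓓(puncturedLine, ℝ), toDist ψ (extendTest t) = 0 := by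
    intro t
    have h2 := (Submodule.mem_orthogonal' _ _).1 hψ (testToL2 (complexTest t)) ⟨_, rfl⟩
    rwa [inner_testToL2_complexTest, map_eq_zero] at h2
  have hloc := locallyIntegrable_L2 ψ
  have h3 : regularDist puncturedLine ψ = regularDist puncturedLine fun _ => 0 := by
    rw [regularDist_zero, ← restrictDist_regularDist hloc]
    ext t
    exact h1 t
  have h4 := ae_eq_of_regularDist_eq (hloc.locallyIntegrableOn _)
    ((locallyIntegrable_const 0).locallyIntegrableOn _) h3
  rw [Lp.eq_zero_iff_ae_eq_zero]
  have h0 : ∀ᵐ x : ℝ, x ≠ 0 := by simp [ae_iff]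
  filter_upwards [h4, h0] with x hx hx0
  exact hx hx0

theorem freeHamiltonian_apply (ψ : L2) (t : 𝓓((⊤ : Opens ℝ), ℝ)) :
    freeHamiltonian ψ t = -toDist ψ (∂_{(1 : ℝ)} (∂_{(1 : ℝ)} t)) := by
  change -(∂_{(1 : ℝ)} (∂_{(1 : ℝ)} (toDist ψ)) : 𝓓'((⊤ : Opens ℝ), ℂ)) t = _
  rw [deriv_dist_apply, deriv_dist_apply, neg_neg]

theorem inner_opS_complexTest (ψ : L2) (t : 𝓓(puncturedLine, ℝ)) :
    inner ℂ ψ (opS ⟨testToL2 (complexTest t), testToL2_mem _⟩) =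
      (starRingEnd ℂ) (freeHamiltonian ψ (extendTest t)) := by
  rw [opS_apply, testDeriv_complexTest, testDeriv_complexTest, inner_neg_right,
    inner_testToL2_complexTest, freeHamiltonian_apply, extendTest_deriv, extendTest_deriv, map_neg]

/-- If `ψ` is in the domain of `S^*` then `S^* ψ = -ψ''` on the punctured line. -/
theorem freeHamiltonian_eq_adjoint (ψ : opS.adjoint.domain) (t : 𝓓(puncturedLine, ℝ)) :
    freeHamiltonian (ψ : L2) (extendTest t) = toDist (opS.adjoint ψ) (extendTest t) := by
  have h := LinearPMap.adjoint_isFormalAdjoint dense_opS_domain ψ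
    ⟨testToL2 (complexTest t), testToL2_mem _⟩
  rw [inner_opS_complexTest, inner_testToL2_complexTest] at h
  exact ((starRingEnd ℂ).injective h).symm

/-- If `-ψ''` is the square integrable function `φ` on the punctured line, then `ψ` is in the
domain of `S^*`. -/
theorem mem_adjoint_domain {ψ φ : L2} (h : ∀ t : 𝓓(puncturedLine, ℝ),
    freeHamiltonian ψ (extendTest t) = toDist φ (extendTest t)) : ψ ∈ opS.adjoint.domain := by
  refine LinearPMap.mem_adjoint_domain_of_exists _ ⟨φ, ?_⟩
  have key : ∀ t : 𝓓(puncturedLine, ℝ), inner ℂ φ (testToL2 (complexTest t)) =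
      inner ℂ ψ (opS ⟨testToL2 (complexTest t), testToL2_mem _⟩) := fun t => by
    rw [inner_opS_complexTest, inner_testToL2_complexTest, h]
  rintro ⟨_, T, rfl⟩
  obtain ⟨u, v, rfl⟩ := exists_re_im_test T
  have hu := key u
  have hv := key v
  change inner ℂ φ (testToL2 _) = inner ℂ ψ (opS ⟨testToL2 _, testToL2_mem _⟩)
  rw [opS_apply] at hu hv ⊢
  simp only [map_add, map_smul, inner_add_right, inner_smul_right, inner_neg_right] at hu hv ⊢
  rw [hu, hv]
  ring

end Adjoint

/-! ### Distributions with vanishing second derivative on an interval -/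

section Interval

variable {Ω : Opens ℝ}

/-- A test function on an interval with zero integral is the derivative of a test function. -/
theorem exists_test_primitive (hΩ : OrdConnected (Ω : Set ℝ)) (s : 𝓓(Ω, ℝ))
    (hs : ∫ x, s x = 0) : ∃ u : 𝓓(Ω, ℝ), ∂_{(1 : ℝ)} u = s := by
  rcases (tsupport s).eq_empty_or_nonempty with he | hne
  · refine ⟨0, ?_⟩
    have h0 : ∀ x, s x = 0 := fun x => image_eq_zero_of_notMem_tsupport (by simp [he])
    ext x
    rw [deriv_test_apply, h0]
    change deriv (fun _ => (0 : ℝ)) x = 0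
    simp
  obtain ⟨A, hA⟩ := s.hasCompactSupport.isCompact.exists_isLeast hne
  obtain ⟨B, hB⟩ := s.hasCompactSupport.isCompact.exists_isGreatest hne
  have hz : ∀ x, x ∉ Icc A B → s x = 0 := fun x hx =>
    image_eq_zero_of_notMem_tsupport fun h => hx ⟨hA.2 h, hB.2 h⟩
  have hd : ∀ x, HasDerivAt (fun y => ∫ z in A..y, s z) (s x) x := fun x =>
    intervalIntegral.integral_hasDerivAt_right (s.continuous.intervalIntegrable _ _)
      (s.continuous.stronglyMeasurableAtFilter _ _) s.continuous.continuousAt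
  have hsupp : Function.support (fun y => ∫ z in A..y, s z) ⊆ Icc A B := by
    intro y hy
    by_contra hyI
    apply hy
    rcases lt_or_ge y A with h | h
    · have hA' : ∀ᵐ z : ℝ, z ≠ A := by simp [ae_iff]
      refine intervalIntegral.integral_zero_ae (hA'.mono fun z hzA hz' => ?_)
      rw [uIoc_of_ge h.le] at hz'
      exact hz z fun h' => hzA (le_antisymm hz'.2 h'.1)
    · have hBy : B < y := not_le.1 fun h' => hyI ⟨h, h'⟩
      change ∫ z in A..y, s z = 0
      rw [← hs, intervalIntegral.integral_of_le h, ← integral_Icc_eq_integral_Ioc]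
      refine setIntegral_eq_integral_of_forall_compl_eq_zero fun x hx => hz x fun h' => hx ?_
      exact ⟨h'.1, h'.2.trans hBy.le⟩
  refine ⟨⟨fun y => ∫ z in A..y, s z, ?_,
    HasCompactSupport.of_support_subset_isCompact isCompact_Icc hsupp,
    (closure_minimal hsupp isClosed_Icc).trans
      (hΩ.out (s.tsupport_subset hA.1) (s.tsupport_subset hB.1))⟩, ?_⟩
  · refine contDiff_infty_iff_deriv.2 ⟨fun x => (hd x).differentiableAt, ?_⟩
    rw [funext fun x => (hd x).deriv]
    exact s.contDiff
  · ext x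
    rw [deriv_test_apply]
    exact (hd x).deriv

/-- A distribution with zero derivative on an interval is constant. -/
theorem eq_const_of_deriv_eq_zero (hΩ : OrdConnected (Ω : Set ℝ)) (hne : (Ω : Set ℝ).Nonempty)
    {F : 𝓓'(Ω, ℂ)} (hF : ∂_{(1 : ℝ)} F = 0) : ∃ c : ℂ, F = regularDist Ω fun _ => c := by
  obtain ⟨b, hb⟩ := hne
  obtain ⟨χ, hχ⟩ : ∃ χ : ContDiffBump b, tsupport χ ⊆ Ω := by
    obtain ⟨r, hr, hr'⟩ := Metric.nhds_basis_closedBall.mem_iff.1 (Ω.isOpen.mem_nhds hb)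
    exact ⟨⟨r / 2, r, by positivity, by linarith⟩, by rwa [ContDiffBump.tsupport_eq]⟩
  -- `ρ` has integral one, so `t - (∫ t) ρ` is the derivative of a test function
  let ρ : 𝓓(Ω, ℝ) := ⟨χ.normed volume, χ.contDiff_normed, χ.hasCompactSupport_normed, by
    rwa [ContDiffBump.tsupport_normed_eq, ← ContDiffBump.tsupport_eq]⟩
  have hint : ∀ t : 𝓓(Ω, ℝ), Integrable t := fun t =>
    t.continuous.integrable_of_hasCompactSupport t.hasCompactSupport
  refine ⟨F ρ, ?_⟩
  ext t
  obtain ⟨u, hu⟩ := exists_test_primitive hΩ (t - (∫ x, t x) • ρ) (by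
    have hρ : ∫ x, ρ x = 1 := χ.integral_normed
    change ∫ x, (t x - (∫ y, t y) * ρ x) = 0
    rw [integral_sub (hint t) ((hint ρ).const_mul _), integral_const_mul, hρ, mul_one, sub_self])
  have h1 : F (∂_{(1 : ℝ)} u) = 0 := by
    have h2 := deriv_dist_apply F u
    rw [hF] at h2
    exact neg_eq_zero.1 h2.symm
  rw [hu, map_sub, map_smul, sub_eq_zero] at h1
  rw [h1, regularDist_apply ((locallyIntegrable_const _).locallyIntegrableOn _),
    integral_mul_const, integral_complex_ofReal, Complex.real_smul]

theorem deriv_linear (c : ℂ) :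
    ∂_{(1 : ℝ)} (regularDist Ω fun x => c * x) = regularDist Ω fun _ => c := by
  have h1 : (fun x : ℝ => c * x) = fun x : ℝ => ∫ _ in (0 : ℝ)..x, c := by
    ext x
    simp [mul_comm]
  have hc : LocallyIntegrable fun _ : ℝ => c := locallyIntegrable_const c
  rw [h1, ← restrictDist_regularDist (continuous_primitive hc 0).locallyIntegrable,
    ← restrictDist_deriv, deriv_primitive hc, restrictDist_regularDist hc]

/-- A distribution with zero second derivative on an interval is affine. -/
theorem eq_affine_of_deriv_deriv_eq_zero (hΩ : OrdConnected (Ω : Set ℝ))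
    (hne : (Ω : Set ℝ).Nonempty) {F : 𝓓'(Ω, ℂ)} (hF : ∂_{(1 : ℝ)} (∂_{(1 : ℝ)} F) = 0) :
    ∃ c d : ℂ, F = regularDist Ω fun x => c * x + d := by
  obtain ⟨c, hc⟩ := eq_const_of_deriv_eq_zero hΩ hne hF
  have hlin : LocallyIntegrable fun x : ℝ => c * x :=
    (continuous_const.mul Complex.continuous_ofReal).locallyIntegrable
  obtain ⟨d, hd⟩ := eq_const_of_deriv_eq_zero hΩ hne
    (F := F + (-1 : ℂ) • regularDist Ω fun x => c * x) (by
      rw [deriv_dist_add, deriv_dist_smul, deriv_linear, hc]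
      ext t
      change regularDist Ω (fun _ => c) t + (-1 : ℂ) • regularDist Ω (fun _ => c) t = 0
      simp)
  refine ⟨c, d, ?_⟩
  rw [regularDist_add hlin (locallyIntegrable_const d), ← hd]
  ext t
  change F t = regularDist Ω (fun x => c * x) t +
    (F t + (-1 : ℂ) • regularDist Ω (fun x => c * x) t)
  simp

end Interval

/-! ### The functions with square integrable second derivative off the origin -/

section Structure

variable {g : ℝ → ℂ}

/-- The solution `-∬ g + c x + d` of `-f'' = g`. -/
def branch (g : ℝ → ℂ) (c d : ℂ) (x : ℝ) : ℂ :=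
  -(∫ y in (0 : ℝ)..x, ∫ z in (0 : ℝ)..y, g z) + (c * x + d)

/-- The derivative `-∫ g + c` of the solution `-∬ g + c x + d` of `-f'' = g`. -/
def branchDeriv (g : ℝ → ℂ) (c : ℂ) (x : ℝ) : ℂ := -(∫ z in (0 : ℝ)..x, g z) + c

theorem continuous_branchDeriv (hg : LocallyIntegrable g) (c : ℂ) : Continuous (branchDeriv g c) :=
  (continuous_primitive hg 0).neg.add continuous_const

theorem hasDerivAt_branch (hg : LocallyIntegrable g) (c d : ℂ) (x : ℝ) :
    HasDerivAt (branch g c d) (branchDeriv g c x) x := by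
  have h1 := intervalIntegral.integral_hasDerivAt_right
    ((continuous_primitive hg 0).intervalIntegrable 0 x)
    ((continuous_primitive hg 0).stronglyMeasurableAtFilter _ _)
    (continuous_primitive hg 0).continuousAt
  have h2 : HasDerivAt (fun x : ℝ => c * (x : ℂ) + d) c x := by
    simpa using ((Complex.ofRealCLM.hasDerivAt (x := x)).const_mul c).add_const d
  exact h1.neg.add h2

theorem contDiff_branch (hg : LocallyIntegrable g) (c d : ℂ) : ContDiff ℝ 1 (branch g c d) := by
  rw [contDiff_one_iff_deriv]
  refine ⟨fun x => (hasDerivAt_branch hg c d x).differentiableAt, ?_⟩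
  rw [funext fun x => (hasDerivAt_branch hg c d x).deriv]
  exact continuous_branchDeriv hg c

/-- The distributional derivative of a function with one jump. -/
theorem deriv_regularDist_jumpFun {p q p' q' : ℝ → ℂ} (hp : ∀ x, HasDerivAt p (p' x) x)
    (hq : ∀ x, HasDerivAt q (q' x) x) (hp' : Continuous p') (hq' : Continuous q') :
    ∂_{(1 : ℝ)} (regularDist ⊤ (jumpFun p q 0)) = jumpDist p' q' (q 0 - p 0) 0 := by
  have hloc := locallyIntegrable_jumpFun hp' hq' 0
  have hH := locallyIntegrable_heaviside 0
  have h1 : jumpFun p q 0 = fun x => (p 0 + (q 0 - p 0) * heaviside 0 x) +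
      ∫ y in (0 : ℝ)..x, jumpFun p' q' 0 y := by
    ext x
    by_cases hx : x < 0
    · have h2 : ∫ y in (0 : ℝ)..x, jumpFun p' q' 0 y = ∫ y in (0 : ℝ)..x, p' y := by
        rw [intervalIntegral.integral_symm, intervalIntegral.integral_symm x]
        congr 1
        refine intervalIntegral.integral_congr_ae ?_
        have h0 : ∀ᵐ x : ℝ, x ≠ 0 := by simp [ae_iff]
        filter_upwards [h0] with y hy hy'
        rw [uIoc_of_le hx.le] at hy'
        simp [jumpFun, lt_of_le_of_ne hy'.2 hy]
      rw [h2, intervalIntegral.integral_eq_sub_of_hasDerivAt (fun y _ => hp y)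
        (hp'.intervalIntegrable _ _)]
      simp [jumpFun, heaviside, hx]
    · have h2 : ∫ y in (0 : ℝ)..x, jumpFun p' q' 0 y = ∫ y in (0 : ℝ)..x, q' y := by
        refine intervalIntegral.integral_congr fun y hy => ?_
        rw [uIcc_of_le (not_lt.1 hx)] at hy
        simp [jumpFun, hy.1]
      rw [h2, intervalIntegral.integral_eq_sub_of_hasDerivAt (fun y _ => hq y)
        (hq'.intervalIntegrable _ _)]
      simp [jumpFun, heaviside, hx]
  have hcH : LocallyIntegrable fun x => (q 0 - p 0) * heaviside 0 x := hH.smul (q 0 - p 0)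
  have hc : LocallyIntegrable fun _ : ℝ => p 0 := locallyIntegrable_const _
  have hsum : LocallyIntegrable fun x => p 0 + (q 0 - p 0) * heaviside 0 x := hc.add hcH
  rw [h1, regularDist_add hsum (continuous_primitive hloc 0).locallyIntegrable,
    regularDist_add hc hcH, regularDist_const_mul hH, deriv_dist_add, deriv_dist_add,
    deriv_dist_smul, deriv_const, deriv_heaviside, deriv_primitive hloc, zero_add, add_comm]
  rfl

/-- The distributional derivative of the derivative of two solutions of `-f'' = g` glued at the
origin. -/
theorem deriv_jumpDist_branchDeriv (hg : LocallyIntegrable g) (c₁ c₂ k : ℂ) :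
    ∂_{(1 : ℝ)} (jumpDist (branchDeriv g c₁) (branchDeriv g c₂) k 0) =
      (-1 : ℂ) • regularDist ⊤ g + (c₂ - c₁) • diracAt 0 0 + k • diracAt 0 1 := by
  have hH := locallyIntegrable_heaviside 0
  have hG : LocallyIntegrable fun x : ℝ => ∫ z in (0 : ℝ)..x, g z :=
    (continuous_primitive hg 0).locallyIntegrable
  have h1 : jumpFun (branchDeriv g c₁) (branchDeriv g c₂) 0 = fun x =>
      (-1 * (∫ z in (0 : ℝ)..x, g z) + (c₂ - c₁) * heaviside 0 x) + c₁ := by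
    ext x
    by_cases hx : x < 0
    · simp [jumpFun, heaviside, hx, branchDeriv]
    · simp [jumpFun, heaviside, hx, branchDeriv]
      ring
  have hcH : LocallyIntegrable fun x => (c₂ - c₁) * heaviside 0 x := hH.smul (c₂ - c₁)
  have hcG : LocallyIntegrable fun x : ℝ => -1 * (∫ z in (0 : ℝ)..x, g z) := hG.smul (-1 : ℂ)
  have hc : LocallyIntegrable fun _ : ℝ => c₁ := locallyIntegrable_const _
  have hsum : LocallyIntegrable fun x : ℝ =>
      -1 * (∫ z in (0 : ℝ)..x, g z) + (c₂ - c₁) * heaviside 0 x := hcG.add hcH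
  rw [jumpDist, h1, regularDist_add hsum hc, regularDist_add hcG hcH, regularDist_const_mul hG,
    regularDist_const_mul hH, deriv_dist_add, deriv_dist_add, deriv_dist_add, deriv_dist_smul,
    deriv_dist_smul, deriv_dist_smul, deriv_const, deriv_heaviside, deriv_primitive hg, add_zero,
    deriv_diracAt]

theorem ordConnected_negHalfLine : OrdConnected (negHalfLine : Set ℝ) := ordConnected_Iio

theorem ordConnected_posHalfLine : OrdConnected (posHalfLine : Set ℝ) := ordConnected_Ioi

theorem halfLine_le_puncturedLine {Ω : Opens ℝ} (hΩ : Ω = negHalfLine ∨ Ω = posHalfLine) :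
    Ω ≤ puncturedLine := by
  rcases hΩ with rfl | rfl
  · exact fun x hx => ne_of_lt (show x < 0 from hx)
  · exact fun x hx => ne_of_gt (show 0 < x from hx)

/-- If `-ψ'' = φ` off the origin, then `ψ` is a solution of this equation in the classical sense
on each interval not containing the origin. -/
theorem exists_ae_eq_branch {ψ φ : L2} (h : ∀ t : 𝓓(puncturedLine, ℝ),
    freeHamiltonian ψ (extendTest t) = toDist φ (extendTest t)) {Ω : Opens ℝ}
    (hΩ : OrdConnected (Ω : Set ℝ)) (hne : (Ω : Set ℝ).Nonempty) (hΩp : Ω ≤ puncturedLine) :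
    ∃ c d : ℂ, ∀ᵐ x, x ∈ Ω → ψ x = branch φ c d x := by
  have hφ := locallyIntegrable_L2 φ
  have hψ := locallyIntegrable_L2 ψ
  have hP : LocallyIntegrable fun x : ℝ => ∫ z in (0 : ℝ)..x, φ z :=
    (continuous_primitive hφ 0).locallyIntegrable
  have hPP : LocallyIntegrable fun x : ℝ => ∫ y in (0 : ℝ)..x, ∫ z in (0 : ℝ)..y, φ z :=
    (continuous_primitive hP 0).locallyIntegrable
  have hsum : LocallyIntegrable fun x => ψ x + ∫ y in (0 : ℝ)..x, ∫ z in (0 : ℝ)..y, φ z :=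
    hψ.add hPP
  have h0 : ∂_{(1 : ℝ)} (∂_{(1 : ℝ)} (regularDist Ω fun x =>
      ψ x + ∫ y in (0 : ℝ)..x, ∫ z in (0 : ℝ)..y, φ z)) = 0 := by
    rw [← restrictDist_regularDist hsum, regularDist_add hψ hPP, ← restrictDist_deriv,
      ← restrictDist_deriv, deriv_dist_add, deriv_primitive hP, deriv_dist_add,
      deriv_primitive hφ]
    ext t
    have htp : tsupport (extendTest t) ⊆ puncturedLine := by
      rw [coe_extendTest]
      exact t.tsupport_subset.trans hΩp
    have h1 := h (cutTest (extendTest t) htp)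
    rw [extendTest_cutTest] at h1
    change (∂_{(1 : ℝ)} (∂_{(1 : ℝ)} (toDist ψ)) : 𝓓'((⊤ : Opens ℝ), ℂ)) (extendTest t) +
      toDist φ (extendTest t) = 0
    rw [← h1]
    exact add_neg_cancel _
  obtain ⟨c, d, hcd⟩ := eq_affine_of_deriv_deriv_eq_zero hΩ hne h0
  refine ⟨c, d, ?_⟩
  have haff : Continuous fun x : ℝ => c * (x : ℂ) + d := by fun_prop
  filter_upwards [ae_eq_of_regularDist_eq (hsum.locallyIntegrableOn _)
    (haff.locallyIntegrable.locallyIntegrableOn _) hcd] with x hx hxΩ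
  rw [branch, ← hx hxΩ]
  ring

/-- The square integrable `ψ` with `-ψ'' = φ` off the origin are two solutions of this equation on
the whole line, glued at the origin. -/
theorem exists_toDist_eq {ψ φ : L2} (h : ∀ t : 𝓓(puncturedLine, ℝ),
    freeHamiltonian ψ (extendTest t) = toDist φ (extendTest t)) :
    ∃ c₁ d₁ c₂ d₂ : ℂ, (∀ᵐ x, x ∈ negHalfLine → ψ x = branch φ c₁ d₁ x) ∧
      (∀ᵐ x, x ∈ posHalfLine → ψ x = branch φ c₂ d₂ x) ∧
      toDist ψ = regularDist ⊤ (jumpFun (branch φ c₁ d₁) (branch φ c₂ d₂) 0) := by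
  obtain ⟨c₁, d₁, h₁⟩ := exists_ae_eq_branch h ordConnected_negHalfLine ⟨-1, by
    change (-1 : ℝ) < 0; norm_num⟩ (halfLine_le_puncturedLine (Or.inl rfl))
  obtain ⟨c₂, d₂, h₂⟩ := exists_ae_eq_branch h ordConnected_posHalfLine ⟨1, by
    change (0 : ℝ) < 1; norm_num⟩ (halfLine_le_puncturedLine (Or.inr rfl))
  refine ⟨c₁, d₁, c₂, d₂, h₁, h₂, ?_⟩
  have hφ := locallyIntegrable_L2 φ
  refine regularDist_congr_ae ?_ ((locallyIntegrable_L2 ψ).locallyIntegrableOn _)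
    ((locallyIntegrable_jumpFun (contDiff_branch hφ c₁ d₁).continuous
      (contDiff_branch hφ c₂ d₂).continuous 0).locallyIntegrableOn _)
  have h0 : ∀ᵐ x : ℝ, x ≠ 0 := by simp [ae_iff]
  filter_upwards [h₁, h₂, h0] with x hx₁ hx₂ hx0 _
  rcases lt_or_gt_of_ne hx0 with hx | hx
  · simp [jumpFun, hx, hx₁ hx]
  · simp [jumpFun, not_lt.2 hx.le, hx₂ hx]

end Structure

/-! ### Square integrability of the first derivative -/

section FirstDerivative

open scoped ENNReal

/-- The integral of `|φ|` over a moving interval of fixed length is square integrable when `φ` is: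
by the Cauchy-Schwarz inequality and Tonelli's theorem. -/
theorem memLp_two_integral_window {φ : ℝ → ℂ} (hφ : MemLp φ 2) :
    MemLp (fun x => ∫ s in (x - 1)..(x + 1), ‖φ s‖) 2 := by
  have hloc : LocallyIntegrable φ := hφ.locallyIntegrable (by norm_num)
  have hint : ∀ c d, IntervalIntegrable (fun s => ‖φ s‖) volume c d := fun _ _ =>
    ((hloc.integrableOn_isCompact isCompact_uIcc).intervalIntegrable).norm
  have hcont : Continuous fun x => ∫ s in (x - 1)..(x + 1), ‖φ s‖ := by
    have h1 := intervalIntegral.continuous_primitive hint 0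
    have h2 : (fun x => ∫ s in (x - 1)..(x + 1), ‖φ s‖) = fun x =>
        (∫ s in (0 : ℝ)..(x + 1), ‖φ s‖) - ∫ s in (0 : ℝ)..(x - 1), ‖φ s‖ := by
      ext x
      rw [intervalIntegral.integral_interval_sub_left (hint _ _) (hint _ _)]
    rw [h2]
    exact (h1.comp (continuous_add_const 1)).sub (h1.comp (continuous_sub_right 1))
  refine ⟨hcont.aestronglyMeasurable, ?_⟩
  rw [eLpNorm_lt_top_iff_lintegral_rpow_enorm_lt_top two_ne_zero ENNReal.ofNat_ne_top]
  have hφ2 := hφ.2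
  rw [eLpNorm_lt_top_iff_lintegral_rpow_enorm_lt_top two_ne_zero ENNReal.ofNat_ne_top] at hφ2
  simp only [ENNReal.toReal_ofNat] at hφ2 ⊢
  have hmeas : AEMeasurable (fun s => ‖φ s‖ₑ ^ (2 : ℝ)) := hφ.1.enorm.pow_const _
  have hpt : ∀ x : ℝ, ‖∫ s in (x - 1)..(x + 1), ‖φ s‖‖ₑ ^ (2 : ℝ) ≤
      2 * ∫⁻ s in Ioc (x - 1) (x + 1), ‖φ s‖ₑ ^ (2 : ℝ) := by
    intro x
    have h1 : ‖∫ s in (x - 1)..(x + 1), ‖φ s‖‖ₑ ≤ ∫⁻ s in Ioc (x - 1) (x + 1), ‖φ s‖ₑ := by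
      rw [intervalIntegral.integral_of_le (by linarith)]
      exact (enorm_integral_le_lintegral_enorm _).trans_eq (by simp)
    have h2 := ENNReal.lintegral_mul_norm_pow_le (μ := volume.restrict (Ioc (x - 1) (x + 1)))
      (f := fun s => ‖φ s‖ₑ ^ (2 : ℝ)) (g := fun _ => 1) hmeas.restrict aemeasurable_const
      (p := 1 / 2) (q := 1 / 2) (by norm_num) (by norm_num) (by norm_num)
    have h3 : ∀ s, (‖φ s‖ₑ ^ (2 : ℝ)) ^ (1 / 2 : ℝ) * (1 : ℝ≥0∞) ^ (1 / 2 : ℝ) = ‖φ s‖ₑ := by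
      intro s
      rw [← ENNReal.rpow_mul]
      simp
    simp only [h3] at h2
    calc _ ≤ ((∫⁻ s in Ioc (x - 1) (x + 1), ‖φ s‖ₑ ^ (2 : ℝ)) ^ (1 / 2 : ℝ) *
          (∫⁻ _ in Ioc (x - 1) (x + 1), 1) ^ (1 / 2 : ℝ)) ^ (2 : ℝ) :=
          ENNReal.rpow_le_rpow (h1.trans h2) (by norm_num)
      _ = 2 * ∫⁻ s in Ioc (x - 1) (x + 1), ‖φ s‖ₑ ^ (2 : ℝ) := by
          rw [ENNReal.mul_rpow_of_nonneg _ _ (by norm_num), ← ENNReal.rpow_mul,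
            ← ENNReal.rpow_mul, mul_comm]
          have : ENNReal.ofReal (1 + 1) = 2 := by norm_num
          simp [this]
  refine (lintegral_mono hpt).trans_lt ?_
  rw [lintegral_const_mul' _ _ (by norm_num)]
  refine ENNReal.mul_lt_top (by norm_num) ?_
  let S : Set (ℝ × ℝ) := {p | p.2 ∈ Ioc (p.1 - 1) (p.1 + 1)}
  have hS : MeasurableSet S :=
    (measurableSet_lt (measurable_fst.sub_const 1) measurable_snd).inter
      (measurableSet_le measurable_snd (measurable_fst.add_const 1))
  have h4 : ∀ x, ∫⁻ s in Ioc (x - 1) (x + 1), ‖φ s‖ₑ ^ (2 : ℝ) =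
      ∫⁻ s, S.indicator (fun p => ‖φ p.2‖ₑ ^ (2 : ℝ)) (x, s) := fun x => by
    rw [← lintegral_indicator measurableSet_Ioc]
    rfl
  simp_rw [h4]
  rw [lintegral_lintegral_swap (f := fun x s => S.indicator (fun p => ‖φ p.2‖ₑ ^ (2 : ℝ)) (x, s))
    ((hmeas.comp_snd).indicator hS)]
  have h5 : ∀ s, ∫⁻ x, S.indicator (fun p => ‖φ p.2‖ₑ ^ (2 : ℝ)) (x, s) =
      ‖φ s‖ₑ ^ (2 : ℝ) * 2 := fun s => by
    have h6 : ∀ x, S.indicator (fun p => ‖φ p.2‖ₑ ^ (2 : ℝ)) (x, s) =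
        (Ico (s - 1) (s + 1)).indicator (fun _ => ‖φ s‖ₑ ^ (2 : ℝ)) x := fun x => by
      have : (x, s) ∈ S ↔ x ∈ Ico (s - 1) (s + 1) := by
        simp only [S, mem_ofPred_eq, mem_Ioc, mem_Ico]
        constructor <;> rintro ⟨h, h'⟩ <;> constructor <;> linarith
      simp only [indicator, this]
    simp_rw [h6]
    rw [lintegral_indicator measurableSet_Ico, setLIntegral_const, Real.volume_Ico,
      show s + 1 - (s - 1) = 2 by ring]
    simp
  simp_rw [h5]
  rw [lintegral_mul_const' _ _ (by norm_num)]
  exact ENNReal.mul_lt_top hφ2 (by norm_num)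

theorem memLp_comp_add {f : ℝ → ℂ} {s : Set ℝ} (hs : MeasurableSet s) {σ : ℝ}
    (hσ : ∀ x ∈ s, x + σ ∈ s) (hf : MemLp f 2 (volume.restrict s)) :
    MemLp (fun x => f (x + σ)) 2 (volume.restrict s) := by
  have h1 := (((memLp_indicator_iff_restrict hs).2 hf).comp_measurePreserving
    (measurePreserving_add_right volume σ)).restrict s
  refine h1.ae_eq ?_
  rw [EventuallyEq, ae_restrict_iff' hs]
  refine Eventually.of_forall fun x hx => ?_
  simp [indicator_of_mem (hσ x hx)]

theorem norm_branchDeriv_sub_le {φ : ℝ → ℂ} (hφ : LocallyIntegrable φ) (c : ℂ) {x y : ℝ}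
    (hy : y ∈ Icc (x - 1) (x + 1)) :
    ‖branchDeriv φ c y - branchDeriv φ c x‖ ≤ ∫ s in (x - 1)..(x + 1), ‖φ s‖ := by
  have hint : ∀ c d, IntervalIntegrable φ volume c d := fun _ _ =>
    (hφ.integrableOn_isCompact isCompact_uIcc).intervalIntegrable
  have h1 : branchDeriv φ c y - branchDeriv φ c x = -∫ s in x..y, φ s := by
    rw [branchDeriv, branchDeriv,
      ← intervalIntegral.integral_interval_sub_left (hint 0 y) (hint 0 x)]
    ring
  rw [h1, norm_neg]
  refine (intervalIntegral.norm_integral_le_integral_norm_uIoc).trans ?_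
  rw [intervalIntegral.integral_of_le (by linarith)]
  refine setIntegral_mono_set ?_ (Eventually.of_forall fun s => norm_nonneg _)
    (LE.le.eventuallyLE ?_)
  · exact ((hφ.integrableOn_isCompact isCompact_Icc).mono_set Ioc_subset_Icc_self).norm
  · intro s hs
    rw [mem_uIoc] at hs
    rcases hs with hs | hs
    · exact ⟨by linarith [hs.1], hs.2.trans hy.2⟩
    · exact ⟨lt_of_le_of_lt hy.1 hs.1, by linarith [hs.2]⟩

/-- If `f` and `f''` are square integrable on a set stable under a translation of length one,
so is `f'`: `f'(x)` differs from a difference quotient of `f` by at most the integral of `|f''|`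
over `[x - 1, x + 1]`. -/
theorem memLp_branchDeriv {φ : ℝ → ℂ} (hφ : MemLp φ 2) (c d : ℂ) {s : Set ℝ}
    (hs : MeasurableSet s) {σ : ℝ} (hσ1 : |σ| = 1) (hσ : ∀ x ∈ s, x + σ ∈ s)
    (hf : MemLp (branch φ c d) 2 (volume.restrict s)) :
    MemLp (branchDeriv φ c) 2 (volume.restrict s) := by
  have hloc : LocallyIntegrable φ := hφ.locallyIntegrable (by norm_num)
  have hbound : MemLp (fun x => ‖branch φ c d (x + σ)‖ + ‖branch φ c d x‖ +
      ∫ s in (x - 1)..(x + 1), ‖φ s‖) 2 (volume.restrict s) :=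
    ((memLp_comp_add hs hσ hf).norm.add hf.norm).add ((memLp_two_integral_window hφ).restrict s)
  refine hbound.mono' (continuous_branchDeriv hloc c).aestronglyMeasurable
    (Eventually.of_forall fun x => ?_)
  have hσle := abs_le.1 hσ1.le
  -- the mean value inequality for `y ↦ f y - f'(x) y` on `[x - 1, x + 1]`
  have h1 := Convex.norm_image_sub_le_of_norm_hasDerivWithin_le (𝕜 := ℝ)
    (f := fun y : ℝ => branch φ c d y - branchDeriv φ c x * y)
    (f' := fun y => branchDeriv φ c y - branchDeriv φ c x) (s := Icc (x - 1) (x + 1)) (x := x)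
    (y := x + σ) (C := ∫ s in (x - 1)..(x + 1), ‖φ s‖)
    (fun y _ => by
      have h2 : HasDerivAt (fun y : ℝ => branchDeriv φ c x * (y : ℂ)) (branchDeriv φ c x) y := by
        simpa using (Complex.ofRealCLM.hasDerivAt (x := y)).const_mul (branchDeriv φ c x)
      exact ((hasDerivAt_branch hloc c d y).sub h2).hasDerivWithinAt)
    (fun y hy => norm_branchDeriv_sub_le hloc c hy) (convex_Icc _ _)
    ⟨by linarith, by linarith⟩ ⟨by linarith [hσle.1], by linarith [hσle.2]⟩
  rw [add_sub_cancel_left, Real.norm_eq_abs, hσ1, mul_one] at h1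
  have h3 : branchDeriv φ c x * (σ : ℂ) = (branch φ c d (x + σ) - branch φ c d x) -
      ((branch φ c d (x + σ) - branchDeriv φ c x * ((x + σ : ℝ) : ℂ)) -
        (branch φ c d x - branchDeriv φ c x * (x : ℂ))) := by
    push_cast
    ring
  have h4 : ‖branchDeriv φ c x‖ = ‖branchDeriv φ c x * (σ : ℂ)‖ := by
    rw [norm_mul, Complex.norm_real, Real.norm_eq_abs, hσ1, mul_one]
  rw [h4, h3]
  refine (norm_sub_le _ _).trans (add_le_add (norm_sub_le _ _) h1)

end FirstDerivative

/-! ### The domain of the adjoint and the boundary operator -/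

section Main

theorem restrictDist_toDist (ψ : L2) (Ω : Opens ℝ) :
    restrictDist Ω (toDist ψ) = regularDist Ω ψ :=
  restrictDist_regularDist (locallyIntegrable_L2 ψ)

/-- A solution of `-ψ'' = φ` off the origin is in `H²` of a half-line, where it is the classical
solution `branch φ c d`. -/
theorem memH2_of_ae_eq_branch {ψ φ : L2} (h : ∀ t : 𝓓(puncturedLine, ℝ),
    freeHamiltonian ψ (extendTest t) = toDist φ (extendTest t)) {Ω : Opens ℝ}
    (hΩp : Ω ≤ puncturedLine) {σ : ℝ} (hσ1 : |σ| = 1) (hσ : ∀ x ∈ (Ω : Set ℝ), x + σ ∈ (Ω : Set ℝ))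
    {c d : ℂ} (hae : ∀ᵐ x, x ∈ Ω → ψ x = branch φ c d x) : MemH2 Ω ψ := by
  have hφ := locallyIntegrable_L2 φ
  have hbr := contDiff_branch hφ c d
  have hae' : (ψ : ℝ → ℂ) =ᵐ[volume.restrict Ω] branch φ c d :=
    (ae_restrict_iff' Ω.isOpen.measurableSet).2 hae
  have hder := (continuous_branchDeriv hφ c).locallyIntegrable (μ := volume)
  have h1 : ∂_{(1 : ℝ)} (regularDist Ω ψ) = regularDist Ω (branchDeriv φ c) := by
    rw [regularDist_congr_ae hae ((locallyIntegrable_L2 ψ).locallyIntegrableOn _)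
      (hbr.continuous.locallyIntegrable.locallyIntegrableOn _)]
    have h2 : branch φ c d = fun x : ℝ => (∫ y in (0 : ℝ)..x, branchDeriv φ c y) + d := by
      ext x
      rw [intervalIntegral.integral_eq_sub_of_hasDerivAt (fun y _ => hasDerivAt_branch hφ c d y)
        ((continuous_branchDeriv hφ c).intervalIntegrable _ _)]
      simp [branch]
    have hsum : LocallyIntegrable fun x : ℝ => (∫ y in (0 : ℝ)..x, branchDeriv φ c y) + d :=
      ((continuous_primitive hder 0).add continuous_const).locallyIntegrable
    rw [h2, ← restrictDist_regularDist hsum, ← restrictDist_deriv, regularDist_add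
      (continuous_primitive hder 0).locallyIntegrable (locallyIntegrable_const d), deriv_dist_add,
      deriv_const, add_zero, deriv_primitive hder, restrictDist_regularDist hder]
  refine ⟨(Lp.memLp ψ).restrict _, ⟨branchDeriv φ c, ?_, h1⟩, fun x => -φ x,
    ((Lp.memLp φ).restrict _).neg, ?_⟩
  · exact memLp_branchDeriv (Lp.memLp φ) c d Ω.isOpen.measurableSet hσ1 hσ
      (((Lp.memLp ψ).restrict _).ae_eq hae')
  · rw [← restrictDist_toDist, ← restrictDist_deriv, ← restrictDist_deriv]
    ext t
    have htp : tsupport (extendTest t) ⊆ puncturedLine := by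
      rw [coe_extendTest]
      exact t.tsupport_subset.trans hΩp
    have h3 := h (cutTest (extendTest t) htp)
    rw [extendTest_cutTest] at h3
    have hnφ : LocallyIntegrable fun x => -φ x := hφ.neg
    rw [restrictDist_apply, regularDist_apply (hnφ.locallyIntegrableOn _)]
    have h4 : (∂_{(1 : ℝ)} (∂_{(1 : ℝ)} (toDist ψ)) : 𝓓'((⊤ : Opens ℝ), ℂ)) (extendTest t) =
        -freeHamiltonian ψ (extendTest t) := (neg_neg _).symm
    rw [h4, h3, toDist_apply, ← integral_neg]
    simp

theorem mem_sobolevSum {ψ φ : L2} (h : ∀ t : 𝓓(puncturedLine, ℝ),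
    freeHamiltonian ψ (extendTest t) = toDist φ (extendTest t)) : ψ ∈ sobolevSum := by
  obtain ⟨c₁, d₁, c₂, d₂, h₁, h₂, -⟩ := exists_toDist_eq h
  refine ⟨memH2_of_ae_eq_branch h (halfLine_le_puncturedLine (Or.inl rfl)) (σ := -1) (by simp)
    (fun x hx => ?_) h₁, memH2_of_ae_eq_branch h (halfLine_le_puncturedLine (Or.inr rfl)) (σ := 1)
    (by simp) (fun x hx => ?_) h₂⟩
  · have hx' : x < 0 := hx
    change x + -1 < 0
    linarith
  · have hx' : 0 < x := hx
    change 0 < x + 1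
    linarith

/-- Distributions which agree on both half-lines agree on the punctured line. -/
theorem eq_on_puncturedLine {F G : 𝓓'((⊤ : Opens ℝ), ℂ)}
    (h₁ : restrictDist negHalfLine F = restrictDist negHalfLine G)
    (h₂ : restrictDist posHalfLine F = restrictDist posHalfLine G) (t : 𝓓(puncturedLine, ℝ)) :
    F (extendTest t) = G (extendTest t) := by
  have h0 : (t : ℝ → ℝ) =ᶠ[𝓝 0] 0 :=
    test_eventuallyEq_zero fun h => t.tsupport_subset h rfl
  -- the part of `t` supported on one side of the origin is smooth
  have hside : ∀ (S : Set ℝ), IsOpen S → (0 : ℝ) ∉ S → closure S ⊆ S ∪ {0} →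
      ContDiff ℝ (⊤ : ℕ∞) (S.indicator t) ∧ tsupport (S.indicator t) ⊆ S := by
    intro S hS h0S hcl
    refine ⟨contDiff_iff_contDiffAt.2 fun x => ?_, fun x hx => ?_⟩
    · by_cases hx : x ∈ S
      · refine t.contDiff.contDiffAt.congr_of_eventuallyEq ?_
        filter_upwards [hS.mem_nhds hx] with y hy
        exact indicator_of_mem hy _
      · refine (contDiffAt_const (c := (0 : ℝ))).congr_of_eventuallyEq ?_
        by_cases hx0 : x = 0
        · rw [hx0]
          filter_upwards [h0] with y hy
          by_cases hyS : y ∈ S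
          · rw [indicator_of_mem hyS, hy]; rfl
          · rw [indicator_of_notMem hyS]
        · have hxc : x ∉ closure S := fun h => (hcl h).elim hx hx0
          filter_upwards [isClosed_closure.isOpen_compl.mem_nhds hxc] with y hy
          exact indicator_of_notMem (fun h => hy (subset_closure h)) _
    · have hx1 : x ∈ closure S := closure_mono (fun y hy => by
        by_contra hyS
        exact hy (indicator_of_notMem hyS _)) hx
      have hx2 : x ∈ tsupport t := closure_mono (fun y hy => by
        rw [Function.mem_support] at hy ⊢
        contrapose! hy
        simp [indicator, hy]) hx
      exact (hcl hx1).resolve_right (t.tsupport_subset hx2)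
  obtain ⟨hs₁, hs₁'⟩ := hside (Iio 0) isOpen_Iio (lt_irrefl (0 : ℝ)) (by
    rw [closure_Iio, Iio_union_right])
  obtain ⟨hs₂, hs₂'⟩ := hside (Ioi 0) isOpen_Ioi (lt_irrefl (0 : ℝ)) (by
    rw [closure_Ioi, Ioi_union_left])
  have hc : ∀ S : Set ℝ, HasCompactSupport (S.indicator t) := fun S =>
    t.hasCompactSupport.mono fun y hy => by
      rw [Function.mem_support] at hy ⊢
      contrapose! hy
      simp [indicator, hy]
  let t₁ : 𝓓(negHalfLine, ℝ) := ⟨(Iio 0).indicator t, hs₁, hc _, hs₁'⟩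
  let t₂ : 𝓓(posHalfLine, ℝ) := ⟨(Ioi 0).indicator t, hs₂, hc _, hs₂'⟩
  have hsplit : extendTest t = extendTest t₁ + extendTest t₂ := by
    ext x
    change extendTest t x = extendTest t₁ x + extendTest t₂ x
    rw [extendTest_apply, extendTest_apply, extendTest_apply]
    change t x = (Iio 0).indicator t x + (Ioi 0).indicator t x
    rcases lt_trichotomy x 0 with hx | rfl | hx
    · simp [indicator, hx, hx.le]
    · simp [h0.eq_of_nhds]
    · simp [indicator, hx, hx.le]
  have e₁ := congrArg (fun K : 𝓓'(negHalfLine, ℂ) => K t₁) h₁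
  have e₂ := congrArg (fun K : 𝓓'(posHalfLine, ℂ) => K t₂) h₂
  simp only [restrictDist_apply] at e₁ e₂
  rw [hsplit, map_add, map_add, e₁, e₂]

/-- For `ψ ∈ H²(ℝ₋) ⊕ H²(ℝ₊)`, the second derivatives on the half-lines form a square integrable
function. -/
theorem exists_of_mem_sobolevSum {ψ : L2} (hψ : ψ ∈ sobolevSum) :
    ∃ φ : L2, ∀ t : 𝓓(puncturedLine, ℝ),
      freeHamiltonian ψ (extendTest t) = toDist φ (extendTest t) := by
  obtain ⟨⟨-, -, u, hu, hu'⟩, -, -, v, hv, hv'⟩ := hψ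
  have hmem : MemLp (-((Iio 0).indicator u + (Ioi 0).indicator v)) 2 (volume : Measure ℝ) :=
    (((memLp_indicator_iff_restrict measurableSet_Iio).2 hu).add
      ((memLp_indicator_iff_restrict measurableSet_Ioi).2 hv)).neg
  refine ⟨hmem.toLp _, eq_on_puncturedLine ?_ ?_⟩
  all_goals
    have hneg : ∀ (Ω : Opens ℝ) (k : ℝ → ℂ), MemLp k 2 (volume.restrict Ω) →
        ∂_{(1 : ℝ)} (∂_{(1 : ℝ)} (regularDist Ω ψ)) = regularDist Ω k →
        (∀ x ∈ Ω, (-((Iio 0).indicator u + (Ioi 0).indicator v)) x = -k x) →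
        restrictDist Ω (freeHamiltonian ψ) = restrictDist Ω (toDist (hmem.toLp _)) := by
      intro Ω k hk hk' hΩ
      have hkloc : LocallyIntegrableOn k Ω :=
        locallyIntegrableOn_of_locallyIntegrable_restrict (hk.locallyIntegrable (by norm_num))
      rw [restrictDist_toDist]
      have e1 : restrictDist Ω (freeHamiltonian ψ) =
          -∂_{(1 : ℝ)} (∂_{(1 : ℝ)} (regularDist Ω ψ)) := by
        rw [← restrictDist_toDist, ← restrictDist_deriv, ← restrictDist_deriv]
        rfl
      rw [e1, hk']
      ext t
      change -(regularDist Ω k t) = _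
      rw [regularDist_apply hkloc,
        regularDist_apply ((locallyIntegrable_L2 _).locallyIntegrableOn _), ← integral_neg]
      refine integral_congr_ae ?_
      filter_upwards [hmem.coeFn_toLp] with x hx
      rw [hx]
      by_cases hxΩ : x ∈ Ω
      · rw [hΩ x hxΩ, mul_neg]
      · have : t x = 0 := image_eq_zero_of_notMem_tsupport fun h => hxΩ (t.tsupport_subset h)
        simp [this]
  · refine hneg _ u hu hu' fun x hx => ?_
    have hx' : x < 0 := hx
    simp [indicator, hx', hx'.le]
  · refine hneg _ v hv hv' fun x hx => ?_
    have hx' : 0 < x := hx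
    simp [indicator, hx', hx'.le]

/-- If `-ψ'' = φ` off the origin, then `(H₀ + 2 β D_x + β') ψ = φ`: the point distributions
produced by the jumps of `ψ` and `ψ'` cancel. -/
theorem mem_boundaryExpr {ψ φ : L2} (h : ∀ t : 𝓓(puncturedLine, ℝ),
    freeHamiltonian ψ (extendTest t) = toDist φ (extendTest t)) :
    toDist φ ∈ boundaryExpr ψ := by
  obtain ⟨c₁, d₁, c₂, d₂, -, -, hψ⟩ := exists_toDist_eq h
  have hφ := locallyIntegrable_L2 φ
  have hD : ∂_{(1 : ℝ)} (toDist ψ) = jumpDist (branchDeriv φ c₁) (branchDeriv φ c₂)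
      (branch φ c₂ d₂ 0 - branch φ c₁ d₁ 0) 0 := by
    rw [hψ]
    exact deriv_regularDist_jumpFun (hasDerivAt_branch hφ c₁ d₁) (hasDerivAt_branch hφ c₂ d₂)
      (continuous_branchDeriv hφ c₁) (continuous_branchDeriv hφ c₂)
  have hψ' : toDist ψ = jumpDist (branch φ c₁ d₁) (branch φ c₂ d₂) 0 0 := by
    rw [hψ, jumpDist]
    ext t
    change _ = regularDist ⊤ _ t + (0 : ℂ) • diracAt 0 0 t
    simp
  have hβ₀ := mem_beta_zero (c := branch φ c₂ d₂ 0 - branch φ c₁ d₁ 0)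
    (continuous_branchDeriv hφ c₁) (continuous_branchDeriv hφ c₂)
  have hβ₁ := mem_beta_one (c := 0) (contDiff_branch hφ c₁ d₁) (contDiff_branch hφ c₂ d₂)
  rw [← hD] at hβ₀
  rw [← hψ', (hasDerivAt_branch hφ c₁ d₁ 0).deriv, (hasDerivAt_branch hφ c₂ d₂ 0).deriv] at hβ₁
  have hsum := Part.add_mem_add _ _ _ _ (Part.add_mem_add _ _ _ _
    (Part.mem_some (freeHamiltonian ψ)) (Part.mem_map (fun G => (2 : ℝ) • G) hβ₀)) hβ₁
  rw [boundaryExpr]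
  convert hsum using 1
  -- the jump terms `[ψ'] δ + [ψ] δ'` of `D_x² ψ`, with `[ψ'] = c₂ - c₁`
  have hDD : freeHamiltonian ψ = -((-1 : ℂ) • regularDist ⊤ φ + (c₂ - c₁) • diracAt 0 0 +
      (branch φ c₂ d₂ 0 - branch φ c₁ d₁ 0) • diracAt 0 1) := by
    rw [freeHamiltonian, hD, deriv_jumpDist_branchDeriv hφ]
  ext t
  rw [hDD]
  change regularDist ⊤ φ t = -((-1 : ℂ) • regularDist ⊤ φ t + (c₂ - c₁) • diracAt 0 0 t +
      (branch φ c₂ d₂ 0 - branch φ c₁ d₁ 0) • diracAt 0 1 t) +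
      (2 : ℝ) • ((branchDeriv φ c₂ 0 - branchDeriv φ c₁ 0) • diracAt 0 0 t) +
      ((branch φ c₂ d₂ 0 - branch φ c₁ d₁ 0) • diracAt 0 1 t -
        (branchDeriv φ c₂ 0 - branchDeriv φ c₁ 0) • diracAt 0 0 t)
  simp only [branchDeriv, intervalIntegral.integral_same, neg_zero, zero_add, smul_eq_mul,
    Complex.real_smul]
  push_cast
  ring

/-- The products with derivatives of the Dirac distribution vanish off the origin, so
`(H₀ + 2 β D_x + β') ψ = φ` implies `-ψ'' = φ` there. -/
theorem eq_of_mem_boundaryExpr {ψ φ : L2} (h : toDist φ ∈ boundaryExpr ψ)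
    (t : 𝓓(puncturedLine, ℝ)) : freeHamiltonian ψ (extendTest t) = toDist φ (extendTest t) := by
  rw [boundaryExpr, Part.add_def] at h
  simp only [Part.bind_eq_bind, Part.mem_bind_iff, Part.mem_map_iff, Part.add_def,
    Part.mem_some_iff] at h
  obtain ⟨_, ⟨_, rfl, _, ⟨A, hA, rfl⟩, rfl⟩, B, hB, hsum⟩ := h
  have ht : (0 : ℝ) ∉ tsupport (extendTest t) := by
    rw [coe_extendTest]
    exact fun h => t.tsupport_subset h rfl
  rw [← hsum]
  change _ = freeHamiltonian ψ (extendTest t) + (2 : ℝ) • A (extendTest t) + B (extendTest t)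
  rw [apply_eq_zero_of_mem_beta hA ht, apply_eq_zero_of_mem_beta hB ht, smul_zero, add_zero,
    add_zero]

end Main

end PointInteraction

end

theorem theorem4p2 :
    (PointInteraction.opS.adjoint.domain : Set PointInteraction.L2) =
        PointInteraction.sobolevSum ∧
      (PointInteraction.opS.adjoint.domain : Set PointInteraction.L2) =
        PointInteraction.maxDomain ∧
      ∀ ψ : PointInteraction.opS.adjoint.domain,
        PointInteraction.toDist (PointInteraction.opS.adjoint ψ) ∈
          PointInteraction.boundaryExpr (ψ : PointInteraction.L2) := by
  open PointInteraction in
  refine ⟨Set.Subset.antisymm (fun ψ hψ => ?_) fun ψ hψ => ?_,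
    Set.Subset.antisymm (fun ψ hψ => ?_) fun ψ hψ => ?_, fun ψ => ?_⟩
  · exact mem_sobolevSum (freeHamiltonian_eq_adjoint ⟨ψ, hψ⟩)
  · obtain ⟨φ, hφ⟩ := exists_of_mem_sobolevSum hψ
    exact mem_adjoint_domain hφ
  · exact ⟨_, mem_boundaryExpr (freeHamiltonian_eq_adjoint ⟨ψ, hψ⟩)⟩
  · obtain ⟨φ, hφ⟩ := hψ
    exact mem_adjoint_domain (eq_of_mem_boundaryExpr hφ)
  · exact mem_boundaryExpr (freeHamiltonian_eq_adjoint ψ)
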